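/- Let $p \ge 0$ be an integer and let $\mathbb{C}_{4p}$ be the complex Clifford algebra with generators $e_1,\dots,e_{4p}$ and relations $e_ie_j+e_je_i=-2\delta_{ij}$. For $k=1,\dots,2p$ put $$\mathfrak{f}_k=-\tfrac12(e_{2k-1}-i\,e_{2k}),\qquad \mathfrak{f}_k^\dagger=\tfrac12(e_{2k-1}+i\,e_{2k}),$$ let $I=\prod_{k=1}^{2p}\mathfrak{f}_k\mathfrak{f}_k^\dagger$, let $\mathbb{S}=\mathbb{C}_{4p}I$ be the spinor space, and let $\mathbb{S}^t\subset\mathbb{S}$ ($0\le t\le 2p$) be the span of all $\mathfrak{f}_{k_1}^\dagger\cdots\mathfrak{f}_{k_t}^\dagger I$. Let $$P=\sum_{j=1}^p\mathfrak{f}_{2j}\mathfrak{f}_{2j-1},\qquad Q=\sum_{j=1}^p\mathfrak{f}_{2j-1}^\dagger\mathfrak{f}_{2j}^\dagger$$ act on $\mathbb{S}$ by left multiplication. The Lie algebra $\mathfrak{sp}_{2p}(\mathbb{C})$ of $2p\times 2p$ matrices preserving infinitesimally the symplectic form with symplectic basis pairs $(2j-1,2j)$, $j=1,\dots,p$, acts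 on $\mathbb{S}$ by left multiplication with bivectors, the matrix $(B_{jk})$ acting as $\sum_{j,k}B_{jk}\,\mathfrak{f}_j^\dagger\mathfrak{f}_k$. Its weights are written in terms of the Cartan elements $\mathfrak{f}_{2j}\mathfrak{f}_{2j}^\dagger-\mathfrak{f}_{2j-1}\mathfrak{f}_{2j-1}^\dagger$, $j=1,\dots,p$, and highest weights are taken with respect to the standard Borel subalgebra; $(1_r)$ denotes the weight $(\underbrace{1,\dots,1}_{r},\underbrace{0,\dots,0}_{p-r})$. For $0\le s\le p$ and $0\le k\le p-s$ define the symplectic cells $$\mathbb{S}_s^{2p-s}=\operatorname{Ker}Q\cap\mathbb{S}^{2p-s},\qquad \mathbb{S}_s^{2p-s-2k}=P^k\,\mathbb{S}_s^{2p-s}.$$ **Theorem.** For every $r=0,\dots,p$, the cell $\mathbb{S}_r^{2p-r}=\operatorname{Ker}Q\cap\mathbb{S}^{2p-r}$ is an $\mathfrak{sp}_{2p}(\mathbb{C})$-submodule of $\mathbb{S}$ and is the irreducible $\mathfrak{sp}_{2p}(\mathbb{C})$-module with highest weight $(1_r)$. Moreover $$\mathbb{S}^{2p-r}=\bigoplus_{j=0}^{\lfloor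 r/2\rfloor}\mathbb{S}_{r-2j}^{2p-r},\qquad \mathbb{S}_{r-2j}^{2p-r}=P^j\,\mathbb{S}_{r-2j}^{2p-r+2j},$$ and each cell $\mathbb{S}_{r-2j}^{2p-r}$ in this direct sum is an irreducible $\mathfrak{sp}_{2p}(\mathbb{C})$-submodule. -/

import Mathlib

attribute [local instance 100] LieRing.ofAssociativeRing

namespace SymplecticSpinor

open LieAlgebra.Symplectic

/-! ### The complex Clifford algebra, its Witt basis and the spinor space

The indices `1, …, 2p` of the Witt basis are encoded by `Fin p ⊕ Fin p`: for `j = 1, …, p`,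
the odd index `2j - 1` is `Sum.inl j` and the even index `2j` is `Sum.inr j`. -/

/-- Index set of the Witt basis: `Sum.inl j` stands for `2j - 1`, `Sum.inr j` for `2j`. -/
abbrev WittIdx (p : ℕ) : Type := Fin p ⊕ Fin p

/-- Index set of the orthonormal basis `e_1, …, e_{4p}`: for `k = 1, …, 2p`, the pair `(k, 0)`
stands for `2k - 1` and the pair `(k, 1)` for `2k`. -/
abbrev EuclIdx (p : ℕ) : Type := WittIdx p × Fin 2

/-- The quadratic form `x ↦ - ∑ i, x_i ^ 2` on `ℂ^{4p}`. -/
noncomputable def form (p : ℕ) : QuadraticForm ℂ (EuclIdx p → ℂ) :=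
  QuadraticMap.weightedSumSquares ℂ (fun _ : EuclIdx p => (-1 : ℂ))

/-- The complex Clifford algebra `ℂ_{4p}`, the complexification of `ℝ_{0,4p}`: it is generated by
`e_1, …, e_{4p}` with `e_i e_j + e_j e_i = -2 δ_{ij}`. -/
abbrev Cl (p : ℕ) : Type := CliffordAlgebra (form p)

/-- The generators of the Clifford algebra. -/
noncomputable def e {p : ℕ} (i : EuclIdx p) : Cl p :=
  CliffordAlgebra.ι (form p) (Pi.single i 1)

/-- The Witt basis vector `f_k = -(1/2) (e_{2k-1} - i e_{2k})`. -/
noncomputable def f {p : ℕ} (k : WittIdx p) : Cl p :=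
  (-(1 / 2) : ℂ) • (e (k, 0) - Complex.I • e (k, 1))

/-- The Witt basis vector `f_k† = (1/2) (e_{2k-1} + i e_{2k})`. -/
noncomputable def fd {p : ℕ} (k : WittIdx p) : Cl p :=
  (1 / 2 : ℂ) • (e (k, 0) + Complex.I • e (k, 1))

/-- The idempotent `I = I_1 I_2 ⋯ I_{2p}`, where `I_k = f_k f_k†`. -/
noncomputable def idem (p : ℕ) : Cl p :=
  ((List.finRange p).map fun j : Fin p =>
    (f (Sum.inl j) * fd (Sum.inl j)) * (f (Sum.inr j) * fd (Sum.inr j))).prod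

/-- The spinor space `𝕊 = ℂ_{4p} I`, the left ideal generated by the idempotent `I`. -/
noncomputable abbrev spinorIdeal (p : ℕ) : Ideal (Cl p) := Ideal.span {idem p}

/-- Spinor space as a type: a left module over the Clifford algebra. -/
abbrev Spinor (p : ℕ) : Type := ↥(spinorIdeal p)

/-- The idempotent `I`, as an element of spinor space. -/
noncomputable def vac (p : ℕ) : Spinor p := ⟨idem p, Ideal.subset_span rfl⟩

/-- The homogeneous spinor space `𝕊^r`, spanned over `ℂ` by the spinors
`f_{k_1}† ⋯ f_{k_r}† I`. -/
noncomputable def homSpinor (p r : ℕ) : Submodule ℂ (Spinor p) :=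
  Submodule.span ℂ (Set.range fun k : Fin r → WittIdx p =>
    (List.ofFn fun i => (fd (k i) : Cl p)).prod • vac p)

/-! ### The operators `P` and `Q` and the symplectic cells -/

/-- `P = f_2 f_1 + f_4 f_3 + ⋯ + f_{2p} f_{2p-1}`, acting on spinors by left multiplication. -/
noncomputable def P (p : ℕ) : Module.End ℂ (Spinor p) :=
  Algebra.lsmul ℂ ℂ (Spinor p) (∑ j : Fin p, f (Sum.inr j) * f (Sum.inl j))

/-- `Q = f_1† f_2† + f_3† f_4† + ⋯ + f_{2p-1}† f_{2p}†`, acting on spinors by left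
multiplication. -/
noncomputable def Q (p : ℕ) : Module.End ℂ (Spinor p) :=
  Algebra.lsmul ℂ ℂ (Spinor p) (∑ j : Fin p, fd (Sum.inl j) * fd (Sum.inr j))

/-- The cell `𝕊_s^{2p-s} = Ker Q ∩ 𝕊^{2p-s}`, for `s ≤ p`. -/
noncomputable def kerCell (p s : ℕ) : Submodule ℂ (Spinor p) :=
  LinearMap.ker (Q p) ⊓ homSpinor p (2 * p - s)

/-- The cell `𝕊_s^{2p-s-2k} = P^k 𝕊_s^{2p-s}`, for `s ≤ p` and `k ≤ p - s`. -/
noncomputable def cell (p s k : ℕ) : Submodule ℂ (Spinor p) :=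
  (kerCell p s).map (P p ^ k)

/-! ### The action of `sp_{2p}(ℂ)` on spinors

`sp_{2p}(ℂ)` is the Lie algebra of block matrices `[[a, b], [c, -aᵀ]]` with `b` and `c` symmetric,
the first block of rows (columns) carrying the odd indices and the second block the even ones.
It is realized in the Clifford algebra by bivectors, the matrix unit `E_{jk}` corresponding to
`f_j† f_k`. For instance `E_{2j-1,2j-1} - E_{2j,2j}` corresponds to
`f_{2j-1}† f_{2j-1} - f_{2j}† f_{2j} = f_{2j} f_{2j}† - f_{2j-1} f_{2j-1}†`, and, for `j ≠ k`,
`E_{2j,2k} - E_{2k-1,2j-1}` to `f_{2j}† f_{2k} + f_{2j-1} f_{2k-1}†`, and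
`-(E_{2k-1,2j} + E_{2j-1,2k})` to `f_{2j} f_{2k-1}† - f_{2j-1}† f_{2k}`. -/

lemma e_mul_add {p : ℕ} (i j : EuclIdx p) :
    e i * e j + e j * e i = algebraMap ℂ (Cl p) (if i = j then -2 else 0) := by
  rw [e, e, CliffordAlgebra.ι_mul_ι_add_swap]
  congr 1
  simp only [form, QuadraticMap.polar, QuadraticMap.weightedSumSquares_apply, Pi.add_apply,
    smul_eq_mul, ← Finset.sum_sub_distrib]
  rw [Finset.sum_congr rfl (g := fun x => if x = i then (if i = j then (-2 : ℂ) else 0) else 0)]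
  · simp
  · intro x _
    by_cases h1 : x = i <;> by_cases h2 : x = j
    · subst h1; subst h2; simp; norm_num
    · subst h1; simp [h2]
    · subst h2; simp [h1]
    · simp [h1, h2]

lemma witt_anticomm {p : ℕ} (j k : WittIdx p) (a b c d : ℂ) :
    (a • e (j, 0) + b • e (j, 1)) * (c • e (k, 0) + d • e (k, 1)) +
      (c • e (k, 0) + d • e (k, 1)) * (a • e (j, 0) + b • e (j, 1)) =
    algebraMap ℂ (Cl p) (if j = k then -2 * (a * c + b * d) else 0) := by
  have h : (a • e (j, 0) + b • e (j, 1)) * (c • e (k, 0) + d • e (k, 1)) +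
      (c • e (k, 0) + d • e (k, 1)) * (a • e (j, 0) + b • e (j, 1)) =
      (a * c) • (e (j, 0) * e (k, 0) + e (k, 0) * e (j, 0) : Cl p) +
      (a * d) • (e (j, 0) * e (k, 1) + e (k, 1) * e (j, 0)) +
      (b * c) • (e (j, 1) * e (k, 0) + e (k, 0) * e (j, 1)) +
      (b * d) • (e (j, 1) * e (k, 1) + e (k, 1) * e (j, 1)) := by
    simp only [add_mul, mul_add, smul_mul_assoc, mul_smul_comm, smul_add, smul_smul]
    rw [mul_comm c a, mul_comm d a, mul_comm c b, mul_comm d b]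
    abel
  rw [h, e_mul_add, e_mul_add, e_mul_add, e_mul_add]
  by_cases hjk : j = k
  · subst hjk
    simp only [Prod.mk.injEq, true_and, if_true, zero_ne_one, one_ne_zero, if_false,
      Algebra.algebraMap_eq_smul_one, smul_smul, ← add_smul]
    congr 1
    ring
  · simp [hjk]

lemma f_eq {p : ℕ} (k : WittIdx p) :
    (f k : Cl p) = (-(1 / 2) : ℂ) • e (k, 0) + (Complex.I / 2) • e (k, 1) := by
  rw [f, smul_sub, smul_smul, sub_eq_add_neg, ← neg_smul]
  congr 2
  ring

lemma fd_eq {p : ℕ} (k : WittIdx p) :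
    (fd k : Cl p) = (1 / 2 : ℂ) • e (k, 0) + (Complex.I / 2) • e (k, 1) := by
  rw [fd, smul_add, smul_smul]
  congr 2
  ring

lemma f_mul_f {p : ℕ} (j k : WittIdx p) : (f j * f k + f k * f j : Cl p) = 0 := by
  rw [f_eq, f_eq, witt_anticomm]
  have : (-2 * (-(1 / 2) * -(1 / 2) + Complex.I / 2 * (Complex.I / 2)) : ℂ) = 0 := by
    linear_combination (-1 / 2 : ℂ) * Complex.I_mul_I
  rw [this, ite_self, map_zero]

lemma fd_mul_fd {p : ℕ} (j k : WittIdx p) : (fd j * fd k + fd k * fd j : Cl p) = 0 := by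
  rw [fd_eq, fd_eq, witt_anticomm]
  have : (-2 * (1 / 2 * (1 / 2) + Complex.I / 2 * (Complex.I / 2)) : ℂ) = 0 := by
    linear_combination (-1 / 2 : ℂ) * Complex.I_mul_I
  rw [this, ite_self, map_zero]

lemma f_mul_fd {p : ℕ} (j k : WittIdx p) :
    (f j * fd k + fd k * f j : Cl p) = if j = k then 1 else 0 := by
  rw [f_eq, fd_eq, witt_anticomm]
  have : (-2 * (-(1 / 2) * (1 / 2) + Complex.I / 2 * (Complex.I / 2)) : ℂ) = 1 := by
    linear_combination (-1 / 2 : ℂ) * Complex.I_mul_I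
  rw [this]
  split_ifs <;> simp

lemma lie_fd_f {p : ℕ} (i j k l : WittIdx p) :
    (⁅fd i * f j, fd k * f l⁆ : Cl p) =
      (if j = k then fd i * f l else 0) - (if i = l then fd k * f j else 0) := by
  have h1 : (f j * fd k : Cl p) = (if j = k then 1 else 0) - fd k * f j :=
    eq_sub_of_add_eq (f_mul_fd j k)
  have h2 : (f l * fd i : Cl p) = (if l = i then 1 else 0) - fd i * f l :=
    eq_sub_of_add_eq (f_mul_fd l i)
  have h3 : (fd i * fd k : Cl p) = -(fd k * fd i) := eq_neg_of_add_eq_zero_left (fd_mul_fd i k)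
  have h4 : (f j * f l : Cl p) = -(f l * f j) := eq_neg_of_add_eq_zero_left (f_mul_f j l)
  have h5 : (fd i * fd k * (f j * f l) : Cl p) = fd k * fd i * (f l * f j) := by
    rw [h3, h4, neg_mul_neg]
  have h6 : (fd i * f j * (fd k * f l) : Cl p) =
      fd i * (if j = k then 1 else 0) * f l - fd i * fd k * (f j * f l) := by
    rw [mul_assoc, ← mul_assoc (f j), h1, sub_mul, mul_sub]
    simp only [mul_assoc]
  have h7 : (fd k * f l * (fd i * f j) : Cl p) =
      fd k * (if l = i then 1 else 0) * f j - fd k * fd i * (f l * f j) := by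
    rw [mul_assoc, ← mul_assoc (f l), h2, sub_mul, mul_sub]
    simp only [mul_assoc]
  rw [LieRing.of_associative_ring_bracket, h6, h7, h5, sub_sub_sub_cancel_right]
  simp only [eq_comm (a := l)]
  split_ifs <;> simp

/-- The matrix `B` is sent to the element `∑ j k, B_{jk} f_j† f_k` of the Clifford algebra. -/
noncomputable def bivectorHom (p : ℕ) : Matrix (WittIdx p) (WittIdx p) ℂ →ₗ⁅ℂ⁆ Cl p where
  toFun B := ∑ j, ∑ k, B j k • (fd j * f k)
  map_add' A B := by simp [add_smul, Finset.sum_add_distrib]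
  map_smul' c B := by simp [mul_smul, Finset.smul_sum]
  map_lie' := by
    intro A B
    have h : (⁅∑ i, ∑ j, A i j • (fd i * f j), ∑ k, ∑ l, B k l • (fd k * f l)⁆ : Cl p) =
        ∑ i, ∑ j, ∑ k, ∑ l, (A i j * B k l) •
          ((if j = k then fd i * f l else 0) - (if i = l then fd k * f j else 0)) := by
      simp only [← lie_fd_f, sum_lie]
      simp only [lie_sum, smul_lie, lie_smul, smul_smul, mul_comm (B _ _)]
    rw [h]
    simp only [LieRing.of_associative_ring_bracket, Matrix.sub_apply, Matrix.mul_apply, sub_smul,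
      smul_sub, Finset.sum_sub_distrib, Finset.sum_smul, smul_ite, smul_zero]
    congr 1
    · refine Finset.sum_congr rfl fun i _ => ?_
      rw [Finset.sum_comm]
      refine Finset.sum_congr rfl fun j _ => ?_
      rw [Finset.sum_comm]
      simp
    · simp only [Finset.sum_ite_eq, Finset.mem_univ, if_true]
      rw [Finset.sum_comm_cycle]
      simp only [mul_comm (A _ _)]
      refine Finset.sum_congr rfl fun i _ => ?_
      rw [Finset.sum_comm]

/-- The Lie algebra `sp_{2p}(ℂ)`. -/
abbrev Sp (p : ℕ) : Type := ↥(sp (Fin p) ℂ)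

/-- The realization of `sp_{2p}(ℂ)` by bivectors in the Clifford algebra. -/
noncomputable def spHom (p : ℕ) : Sp p →ₗ⁅ℂ⁆ Cl p :=
  (bivectorHom p).comp (sp (Fin p) ℂ).incl

/-- `sp_{2p}(ℂ)` acts on spinors by left multiplication with the corresponding bivector. -/
noncomputable instance spinorLieRingModule (p : ℕ) : LieRingModule (Sp p) (Spinor p) :=
  letI : LieRingModule (Cl p) (Spinor p) := LieRingModule.ofAssociativeModule
  LieRingModule.compLieHom (Spinor p) (spHom p)

lemma sp_lie_def {p : ℕ} (A : Sp p) (s : Spinor p) : ⁅A, s⁆ = spHom p A • s := rfl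

instance spinorLieModule (p : ℕ) : LieModule ℂ (Sp p) (Spinor p) where
  smul_lie c A s := by simp [sp_lie_def]
  lie_smul c A s := by simp only [sp_lie_def]; exact smul_comm _ _ _

/-! ### Highest weights for `sp_{2p}(ℂ)` -/

/-- `v` is a highest weight vector of weight `lam = (lam_1, …, lam_p)`: it is nonzero, and the
standard Borel subalgebra (the matrices `[[a, b], [0, -aᵀ]]` in `sp_{2p}(ℂ)` with `a` upper
triangular) acts on it through the character `∑ i, lam_i L_i`, where `L_i` is the `i`-th diagonal
entry of `a`. -/
structure IsHighestWeightVector {p : ℕ} {M : Type*} [AddCommGroup M] [Module ℂ M]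
    [LieRingModule (Sp p) M] (lam : Fin p → ℂ) (v : M) : Prop where
  ne_zero : v ≠ 0
  lie_eq : ∀ A : Sp p,
    (∀ i j : Fin p, A.1 (Sum.inr i) (Sum.inl j) = 0) →
    (∀ i j : Fin p, j < i → A.1 (Sum.inl i) (Sum.inl j) = 0) →
    ⁅A, v⁆ = (∑ i, lam i * A.1 (Sum.inl i) (Sum.inl i)) • v

/-- `M` is an irreducible `sp_{2p}(ℂ)`-module with highest weight `lam`. -/
structure IsIrreducibleOfHighestWeight {p : ℕ} (M : Type*) [AddCommGroup M] [Module ℂ M]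
    [LieRingModule (Sp p) M] (lam : Fin p → ℂ) : Prop where
  irreducible : LieModule.IsIrreducible ℂ (Sp p) M
  exists_highestWeightVector : ∃ v : M, IsHighestWeightVector lam v

/-- The weight `(1_r) = (1, …, 1, 0, …, 0)`, with `r` entries `1` and `p - r` entries `0`. -/
def oneWeight (p r : ℕ) : Fin p → ℂ := fun i => if (i : ℕ) < r then 1 else 0

end SymplecticSpinor

namespace SymplecticSpinor

open LieAlgebra.Symplectic

/-! ### The vacuum vector does not vanish -/

/-! Spinor space is a fermionic Fock space: `f k` annihilates, `fd k` creates, and the idempotent is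
the vacuum. It is nonzero because it fixes `1` in a representation on the exterior algebra. The
anticommutation relations alone then yield a basis indexed by finite sets of indices, on which every
`c k ∘ a k` is a diagonal projection, and a symmetric bilinear form making creation and annihilation
adjoint. So the rest is done for an abstract `IsFock`.

The operators Q (`raise`) and P (`lower`) commute with `sp` (`raise_bivector`, `lower_bivector`) and
satisfy [Q, P] = N - p with N the number operator (`raise_lower`). This is an sl₂ action commuting
with `sp`, and the decomposition is its usual decomposition into strings starting at vectors killed
by Q: the summands are independent as eigenspaces of PQ, and they exhaust the degree by induction.

Irreducibility rests on uniqueness of highest weight vectors. A nonzero invariant subspace contains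
a vector killed by the positive root operators (`exists_highest`). If it also lies in Ker Q and has
degree 2p - r, these equations, rewritten through number operators, leave a single basis vector
(`eq_highestSet_of_highest`). An invariant subspace and its orthogonal in the cell cannot both
contain this vector, which pairs to 1 with itself; so the orthogonal vanishes and a dimension count
concludes (`eq_primitive_of_invariant`). Powers of P carry this to the other cells. -/

lemma f_mul_self {p : ℕ} (k : WittIdx p) : (f k * f k : Cl p) = 0 := by
  have h : ((2 : ℂ) • (f k * f k) : Cl p) = 0 := by rw [two_smul]; exact f_mul_f k k
  exact (smul_eq_zero.1 h).resolve_left two_ne_zero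

/-- The creation part of a Euclidean vector. -/
noncomputable def creation (p : ℕ) : (EuclIdx p → ℂ) →ₗ[ℂ] (WittIdx p → ℂ) where
  toFun x k := x (k, 0) - Complex.I * x (k, 1)
  map_add' x y := by ext k; simp; ring
  map_smul' c x := by ext k; simp; ring

/-- The annihilation part of a Euclidean vector. -/
noncomputable def annihilation (p : ℕ) : (EuclIdx p → ℂ) →ₗ[ℂ] Module.Dual ℂ (WittIdx p → ℂ) where
  toFun x := ∑ k, (-(x (k, 0) + Complex.I * x (k, 1))) • LinearMap.proj k
  map_add' x y := by
    rw [← Finset.sum_add_distrib]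
    refine Finset.sum_congr rfl fun k _ => ?_
    rw [← add_smul]; congr 1; simp; ring
  map_smul' c x := by
    rw [Finset.smul_sum]
    refine Finset.sum_congr rfl fun k _ => ?_
    rw [smul_smul]; congr 1; simp; ring

/-- Each index contributes -(x₀ + i x₁)(x₀ - i x₁) = -(x₀² + x₁²), which is the Clifford relation
needed for `fockVec`. -/
lemma annihilation_creation {p : ℕ} (x : EuclIdx p → ℂ) :
    annihilation p x (creation p x) = form p x := by
  simp only [annihilation, creation, form, LinearMap.coe_mk, AddHom.coe_mk, LinearMap.sum_apply,
    LinearMap.smul_apply, LinearMap.proj_apply, smul_eq_mul,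
    QuadraticMap.weightedSumSquares_apply, Fintype.sum_prod_type, Fin.sum_univ_two]
  refine Finset.sum_congr rfl fun k _ => ?_
  linear_combination (x (k, 1) ^ 2) * Complex.I_mul_I

/-- The action of Euclidean vectors on the exterior algebra. -/
noncomputable def fockVec (p : ℕ) :
    (EuclIdx p → ℂ) →ₗ[ℂ] Module.End ℂ (ExteriorAlgebra ℂ (WittIdx p → ℂ)) :=
  (LinearMap.mul ℂ (ExteriorAlgebra ℂ (WittIdx p → ℂ))) ∘ₗ
      (ExteriorAlgebra.ι ℂ) ∘ₗ creation p +
    CliffordAlgebra.contractLeft ∘ₗ annihilation p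

lemma fockVec_apply {p : ℕ} (x : EuclIdx p → ℂ) (y : ExteriorAlgebra ℂ (WittIdx p → ℂ)) :
    fockVec p x y = ExteriorAlgebra.ι ℂ (creation p x) * y +
      CliffordAlgebra.contractLeft (annihilation p x) y := rfl

/-- Wedging and contracting each square to zero; their anticommutator is the scalar pairing of the
two parts. -/
lemma fockVec_mul_self {p : ℕ} (x : EuclIdx p → ℂ) :
    fockVec p x * fockVec p x = algebraMap ℂ _ (form p x) := by
  refine LinearMap.ext fun y => ?_
  rw [Module.End.mul_apply, fockVec_apply, fockVec_apply, map_add, mul_add, ← mul_assoc,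
    ExteriorAlgebra.ι_sq_zero, zero_mul, CliffordAlgebra.contractLeft_contractLeft,
    show ExteriorAlgebra.ι ℂ (creation p x) = CliffordAlgebra.ι 0 (creation p x) from rfl,
    CliffordAlgebra.contractLeft_ι_mul, annihilation_creation, Module.algebraMap_end_apply]
  abel

/-- The Fock representation of the Clifford algebra on the exterior algebra. -/
noncomputable def fock (p : ℕ) :
    Cl p →ₐ[ℂ] Module.End ℂ (ExteriorAlgebra ℂ (WittIdx p → ℂ)) :=
  CliffordAlgebra.lift (form p) ⟨fockVec p, fockVec_mul_self⟩

lemma fock_f_mul_fd_one {p : ℕ} (k : WittIdx p) : fock p (f k * fd k) 1 = 1 := by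
  have hc : ∀ (a b : ℂ), creation p (a • Pi.single (k, 0) 1 + b • Pi.single (k, 1) 1) =
      (a - Complex.I * b) • Pi.single k 1 := by
    intro a b
    ext l
    by_cases h : l = k
    · subst h; simp [creation]
    · simp [creation, h]
  have ha : ∀ (a b : ℂ), annihilation p (a • Pi.single (k, 0) 1 + b • Pi.single (k, 1) 1) =
      (-(a + Complex.I * b)) • LinearMap.proj k := by
    intro a b
    simp only [annihilation, LinearMap.coe_mk, AddHom.coe_mk]
    rw [Finset.sum_eq_single k]
    · simp
    · intro l _ h
      simp [h]
    · simp
  have hv : ∀ (a b : ℂ), fock p (a • e (k, 0) + b • e (k, 1)) =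
      fockVec p (a • Pi.single (k, 0) 1 + b • Pi.single (k, 1) 1) := by
    intro a b
    simp only [e, ← map_smul, ← map_add]
    simp [fock, CliffordAlgebra.lift_ι_apply]
  -- The coefficients say that `fd k` acts as pure wedging (`h1`, `h2`) and `f k` as pure
  -- contraction (`h3`, `h4`).
  have h1 : (1 / 2 : ℂ) - Complex.I * (Complex.I / 2) = 1 := by
    linear_combination (-1 / 2 : ℂ) * Complex.I_mul_I
  have h2 : -((1 / 2 : ℂ) + Complex.I * (Complex.I / 2)) = 0 := by
    linear_combination (-1 / 2 : ℂ) * Complex.I_mul_I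
  have h3 : -(1 / 2 : ℂ) - Complex.I * (Complex.I / 2) = 0 := by
    linear_combination (-1 / 2 : ℂ) * Complex.I_mul_I
  have h4 : -(-(1 / 2 : ℂ) + Complex.I * (Complex.I / 2)) = 1 := by
    linear_combination (-1 / 2 : ℂ) * Complex.I_mul_I
  rw [map_mul, Module.End.mul_apply, f_eq, fd_eq, hv, hv, fockVec_apply, fockVec_apply, hc, hc,
    ha, ha, h1, h2, h3, h4]
  simp only [one_smul, zero_smul, map_zero, zero_mul, zero_add, mul_one, LinearMap.zero_apply,
    add_zero]
  rw [show (ExteriorAlgebra.ι ℂ (Pi.single k (1 : ℂ)) : ExteriorAlgebra ℂ (WittIdx p → ℂ)) =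
    CliffordAlgebra.ι 0 (Pi.single k 1) from rfl, CliffordAlgebra.contractLeft_ι]
  simp

lemma fock_idem_one {p : ℕ} : fock p (idem p) 1 = 1 := by
  rw [idem]
  induction List.finRange p with
  | nil => simp
  | cons j L ih =>
    rw [List.map_cons, List.prod_cons, map_mul, Module.End.mul_apply, ih, map_mul,
      Module.End.mul_apply, fock_f_mul_fd_one, fock_f_mul_fd_one]

lemma vac_ne_zero (p : ℕ) : vac p ≠ 0 := by
  intro h
  have h1 : idem p = 0 := congrArg Subtype.val h
  have h2 := fock_idem_one (p := p)
  rw [h1, map_zero, LinearMap.zero_apply] at h2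
  exact zero_ne_one h2

/-! ### Annihilation of the vacuum -/

lemma f_comm_pair {p : ℕ} {k l : WittIdx p} (h : k ≠ l) :
    (f k * (f l * fd l) : Cl p) = f l * fd l * f k := by
  have h1 : (f k * f l : Cl p) = -(f l * f k) := eq_neg_of_add_eq_zero_left (f_mul_f k l)
  have h2 : (f k * fd l : Cl p) = -(fd l * f k) :=
    eq_neg_of_add_eq_zero_left (by rw [f_mul_fd, if_neg h])
  rw [← mul_assoc, h1, neg_mul, mul_assoc, h2, mul_neg, neg_neg, mul_assoc]

/-- `f k` commutes with the factors of all other indices, until it meets its own factor `f k * fd k`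
and `f k * f k = 0` applies. -/
lemma f_mul_idem {p : ℕ} (k : WittIdx p) : (f k * idem p : Cl p) = 0 := by
  have hself : ∀ l : WittIdx p, (f l * (f l * fd l) : Cl p) = 0 := fun l => by
    rw [← mul_assoc, f_mul_self, zero_mul]
  have key : ∀ (L : List (Fin p)), Sum.elim id id k ∈ L →
      (f k * (L.map fun j : Fin p =>
        (f (Sum.inl j) * fd (Sum.inl j)) * (f (Sum.inr j) * fd (Sum.inr j))).prod : Cl p) = 0 := by
    intro L
    induction L with
    | nil => simp
    | cons j L ih =>
      intro hk
      rw [List.map_cons, List.prod_cons, ← mul_assoc]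
      by_cases hj : Sum.elim id id k = j
      · rcases k with i | i <;> obtain rfl : i = j := hj
        · rw [← mul_assoc (f _), hself, zero_mul, zero_mul]
        · rw [← mul_assoc (f _), f_comm_pair Sum.inr_ne_inl, mul_assoc (_ * _) (f _),
            hself, mul_zero, zero_mul]
      · have hl : k ≠ Sum.inl j := by rintro rfl; exact hj rfl
        have hr : k ≠ Sum.inr j := by rintro rfl; exact hj rfl
        rw [← mul_assoc, f_comm_pair hl, mul_assoc (_ * _) (f k), f_comm_pair hr,
          ← mul_assoc, mul_assoc _ (f k), ih ((List.mem_cons.1 hk).resolve_left hj), mul_zero]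
  exact key _ (List.mem_finRange _)

lemma f_smul_vac {p : ℕ} (k : WittIdx p) : (f k : Cl p) • vac p = 0 :=
  Subtype.ext (f_mul_idem k)


end SymplecticSpinor

namespace SymplecticSpinor

/-! ### Fock spaces -/

/-- `M` is a Fock space: the operators `a k` (annihilation) and `c k` (creation) satisfy the
canonical anticommutation relations, and `M` is generated by the vacuum vector `Ω`. -/
structure IsFock {ι M : Type*} [DecidableEq ι] [AddCommGroup M] [Module ℂ M]
    (a c : ι → Module.End ℂ M) (Ω : M) : Prop where
  a_a : ∀ j k v, a j (a k v) = -a k (a j v)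
  c_c : ∀ j k v, c j (c k v) = -c k (c j v)
  a_c : ∀ j k v, a j (c k v) = (if j = k then v else 0) - c k (a j v)
  a_vac : ∀ k, a k Ω = 0
  vac_ne_zero : Ω ≠ 0
  cyclic : ∀ W : Submodule ℂ M, Ω ∈ W → (∀ k, ∀ v ∈ W, a k v ∈ W) →
    (∀ k, ∀ v ∈ W, c k v ∈ W) → ⊤ ≤ W

set_option linter.unusedSectionVars false

namespace IsFock

variable {ι M : Type*} [DecidableEq ι] [AddCommGroup M] [Module ℂ M]
  {a c : ι → Module.End ℂ M} {Ω : M}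

lemma c_c_self (h : IsFock a c Ω) (k : ι) (v : M) : c k (c k v) = 0 := by
  have h2 := h.c_c k k v
  rw [eq_neg_iff_add_eq_zero, ← two_smul ℂ] at h2
  exact (smul_eq_zero.1 h2).resolve_left two_ne_zero

lemma a_c_self (h : IsFock a c Ω) (k : ι) (v : M) : a k (c k v) = v - c k (a k v) := by
  rw [h.a_c, if_pos rfl]

lemma a_c_of_ne (h : IsFock a c Ω) {j k : ι} (hjk : j ≠ k) (v : M) :
    a j (c k v) = -c k (a j v) := by
  rw [h.a_c, if_neg hjk, zero_sub]

lemma c_a_of_ne (h : IsFock a c Ω) {j k : ι} (hjk : j ≠ k) (v : M) :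
    c j (a k v) = -a k (c j v) := by
  rw [h.a_c_of_ne hjk.symm, neg_neg]

/-- The vector `c_{k_1} ⋯ c_{k_t} Ω`. -/
def listVec (c : ι → Module.End ℂ M) (Ω : M) (L : List ι) : M :=
  L.foldr (fun k v => c k v) Ω

lemma a_listVec (h : IsFock a c Ω) {k : ι} {L : List ι} (hk : k ∉ L) :
    a k (listVec c Ω L) = 0 := by
  induction L with
  | nil => exact h.a_vac k
  | cons l L ih =>
    rw [List.mem_cons, not_or] at hk
    change a k (c l (listVec c Ω L)) = 0
    rw [h.a_c_of_ne hk.1, ih hk.2, map_zero, neg_zero]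

lemma c_listVec (h : IsFock a c Ω) {k : ι} {L : List ι} (hk : k ∈ L) :
    c k (listVec c Ω L) = 0 := by
  induction L with
  | nil => simp at hk
  | cons l L ih =>
    change c k (c l (listVec c Ω L)) = 0
    by_cases hkl : k = l
    · rw [hkl, h.c_c_self]
    · rw [h.c_c, ih ((List.mem_cons.1 hk).resolve_left hkl), map_zero, neg_zero]

/-- Each swap costs a sign. Signs are recorded only as scalars of square 1, so no ordering of the
indices is ever needed. -/
lemma listVec_perm (h : IsFock a c Ω) {L L' : List ι} (hL : L.Perm L') :
    ∃ ε : ℂ, ε * ε = 1 ∧ listVec c Ω L = ε • listVec c Ω L' := by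
  induction hL with
  | nil => exact ⟨1, by simp⟩
  | cons k _ ih =>
    obtain ⟨ε, h1, h2⟩ := ih
    refine ⟨ε, h1, ?_⟩
    change c k (listVec c Ω _) = ε • c k (listVec c Ω _)
    rw [h2, map_smul]
  | swap k l L =>
    refine ⟨-1, by simp, ?_⟩
    change c l (c k (listVec c Ω L)) = (-1 : ℂ) • c k (c l (listVec c Ω L))
    rw [h.c_c, neg_one_smul]
  | trans _ _ ih1 ih2 =>
    obtain ⟨ε, h1, h2⟩ := ih1
    obtain ⟨δ, h3, h4⟩ := ih2
    exact ⟨ε * δ, by rw [mul_mul_mul_comm, h1, h3, one_mul], by rw [h2, h4, smul_smul]⟩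

/-- The vector attached to a finite set of indices: up to sign, the product of its creation
operators applied to the vacuum. -/
noncomputable def setVec (c : ι → Module.End ℂ M) (Ω : M) (T : Finset ι) : M :=
  listVec c Ω T.toList

lemma setVec_empty : setVec c Ω ∅ = Ω := by
  rw [setVec, Finset.toList_empty]; rfl

lemma c_setVec_of_mem (h : IsFock a c Ω) {k : ι} {T : Finset ι} (hk : k ∈ T) :
    c k (setVec c Ω T) = 0 :=
  h.c_listVec (Finset.mem_toList.2 hk)

lemma a_setVec_of_notMem (h : IsFock a c Ω) {k : ι} {T : Finset ι} (hk : k ∉ T) :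
    a k (setVec c Ω T) = 0 :=
  h.a_listVec (by simpa using hk)

/-- The same sign serves both directions because it is its own inverse; this is what later makes `a
k` and `c k` adjoint. -/
lemma exists_sign (h : IsFock a c Ω) {k : ι} {T : Finset ι} (hk : k ∉ T) :
    ∃ ε : ℂ, ε * ε = 1 ∧ c k (setVec c Ω T) = ε • setVec c Ω (insert k T) ∧
      a k (setVec c Ω (insert k T)) = ε • setVec c Ω T := by
  obtain ⟨ε, h1, h2⟩ := h.listVec_perm (Finset.toList_insert hk)
  change setVec c Ω (insert k T) = ε • c k (setVec c Ω T) at h2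
  refine ⟨ε, h1, ?_, ?_⟩
  · rw [h2, smul_smul, h1, one_smul]
  · rw [h2, map_smul, h.a_c_self, h.a_setVec_of_notMem hk, map_zero, sub_zero]

lemma c_a_setVec (h : IsFock a c Ω) (k : ι) (T : Finset ι) :
    c k (a k (setVec c Ω T)) = if k ∈ T then setVec c Ω T else 0 := by
  split_ifs with hk
  · obtain ⟨ε, h1, h2, h3⟩ := h.exists_sign (Finset.notMem_erase k T)
    rw [Finset.insert_erase hk] at h2 h3
    rw [h3, map_smul, h2, smul_smul, h1, one_smul]
  · rw [h.a_setVec_of_notMem hk, map_zero]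

lemma setVec_ne_zero (h : IsFock a c Ω) (T : Finset ι) : setVec c Ω T ≠ 0 := by
  induction T using Finset.induction_on with
  | empty => rw [setVec_empty]; exact h.vac_ne_zero
  | insert k T hk ih =>
    obtain ⟨ε, h1, h2, h3⟩ := h.exists_sign hk
    intro h0
    rw [h0, map_zero] at h3
    rcases smul_eq_zero.1 h3.symm with h4 | h4
    · simp [h4] at h1
    · exact ih h4

/-- Weighting the number operators by distinct powers of 2 gives an operator whose eigenvalue on a
set is its binary code, so distinct sets have distinct eigenvalues. -/
lemma setVec_linearIndependent [Fintype ι] (h : IsFock a c Ω) :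
    LinearIndependent ℂ (setVec c Ω) := by
  let w : ι ↪ ℕ := (Fintype.equivFin ι).toEmbedding.trans Fin.valEmbedding
  let D : Module.End ℂ M := ∑ k, ((2 ^ w k : ℕ) : ℂ) • (c k * a k)
  let μ : Finset ι → ℂ := fun T => ((∑ i ∈ T.map w, 2 ^ i : ℕ) : ℂ)
  have hμ : Function.Injective μ :=
    Nat.cast_injective.comp ((Finset.geomSum_injective le_rfl).comp (Finset.map_injective w))
  refine Module.End.eigenvectors_linearIndependent' D μ hμ _ fun T => ⟨?_, h.setVec_ne_zero T⟩
  rw [Module.End.mem_eigenspace_iff]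
  simp only [D, μ, LinearMap.sum_apply, LinearMap.smul_apply, Module.End.mul_apply, h.c_a_setVec,
    Finset.sum_map, Nat.cast_sum, Finset.sum_smul, smul_ite, smul_zero]
  rw [Finset.sum_ite_mem, Finset.univ_inter]

lemma span_setVec (h : IsFock a c Ω) : ⊤ ≤ Submodule.span ℂ (Set.range (setVec c Ω)) := by
  set W := Submodule.span ℂ (Set.range (setVec c Ω)) with hW
  have hmem : ∀ T, setVec c Ω T ∈ W := fun T => Submodule.subset_span ⟨T, rfl⟩
  have hstab : ∀ g : Module.End ℂ M, (∀ T, g (setVec c Ω T) ∈ W) → ∀ v ∈ W, g v ∈ W := by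
    intro g hg v hv
    have : W ≤ W.comap g := Submodule.span_le.2 (by rintro _ ⟨T, rfl⟩; exact hg T)
    exact this hv
  refine h.cyclic W (by simpa [setVec_empty] using hmem ∅) (fun k => hstab _ fun T => ?_)
    (fun k => hstab _ fun T => ?_)
  · by_cases hk : k ∈ T
    · obtain ⟨ε, -, -, h3⟩ := h.exists_sign (Finset.notMem_erase k T)
      rw [Finset.insert_erase hk] at h3
      rw [h3]
      exact W.smul_mem _ (hmem _)
    · rw [h.a_setVec_of_notMem hk]; exact W.zero_mem
  · by_cases hk : k ∈ T
    · rw [h.c_setVec_of_mem hk]; exact W.zero_mem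
    · obtain ⟨ε, -, h2, -⟩ := h.exists_sign hk
      rw [h2]
      exact W.smul_mem _ (hmem _)

variable [Fintype ι]

/-- The basis of a Fock space formed by the products of creation operators applied to the
vacuum. -/
noncomputable def basis (h : IsFock a c Ω) : Module.Basis (Finset ι) ℂ M :=
  Module.Basis.mk h.setVec_linearIndependent h.span_setVec

lemma basis_apply (h : IsFock a c Ω) (T : Finset ι) : h.basis T = setVec c Ω T := by
  simp [basis]


lemma finite (h : IsFock a c Ω) : Module.Finite ℂ M := Module.Finite.of_basis h.basis

/-- Relations among number operators thus become conditions on the sets that occur in a vector; the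
highest weight analysis depends on this. -/
lemma repr_c_a (h : IsFock a c Ω) (k : ι) (v : M) (T : Finset ι) :
    h.basis.repr (c k (a k v)) T = if k ∈ T then h.basis.repr v T else 0 := by
  have key : h.basis.coord T ∘ₗ (c k * a k) =
      (if k ∈ T then (1 : ℂ) else 0) • h.basis.coord T := by
    refine h.basis.ext fun U => ?_
    rw [LinearMap.comp_apply, Module.End.mul_apply, LinearMap.smul_apply, h.basis_apply,
      h.c_a_setVec, ← h.basis_apply]
    by_cases hU : U = T
    · subst hU
      split_ifs <;> simp
    · split_ifs <;> simp [hU]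
  have key2 := LinearMap.congr_fun key v
  rw [LinearMap.smul_apply, smul_eq_mul, ite_mul, one_mul, zero_mul] at key2
  exact key2

/-- The symmetric bilinear form for which the basis of products of creation operators is
orthonormal. -/
noncomputable def bform (h : IsFock a c Ω) : M →ₗ[ℂ] M →ₗ[ℂ] ℂ := h.basis.toDual

lemma bform_setVec (h : IsFock a c Ω) (T U : Finset ι) :
    h.bform (setVec c Ω T) (setVec c Ω U) = if T = U then 1 else 0 := by
  rw [← h.basis_apply, ← h.basis_apply, bform, Module.Basis.toDual_apply]

lemma bform_comm (h : IsFock a c Ω) (v w : M) : h.bform v w = h.bform w v := by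
  have : h.bform = h.bform.flip := by
    refine h.basis.ext fun T => h.basis.ext fun U => ?_
    rw [LinearMap.flip_apply, h.basis_apply, h.basis_apply, bform_setVec, bform_setVec]
    simp only [eq_comm]
  conv_lhs => rw [this]
  rfl

lemma eq_of_bform (h : IsFock a c Ω) {v w : M} (hvw : ∀ x, h.bform v x = h.bform w x) : v = w :=
  h.basis.toDual_injective (LinearMap.ext hvw)

lemma bform_a (h : IsFock a c Ω) (k : ι) (v w : M) : h.bform (a k v) w = h.bform v (c k w) := by
  have : h.bform ∘ₗ a k = h.bform.compl₂ (c k) := by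
    refine h.basis.ext fun T => h.basis.ext fun U => ?_
    rw [LinearMap.comp_apply, LinearMap.compl₂_apply, h.basis_apply, h.basis_apply]
    by_cases hT : k ∈ T
    · obtain ⟨ε, h1, h2, h3⟩ := h.exists_sign (Finset.notMem_erase k T)
      rw [Finset.insert_erase hT] at h2 h3
      rw [h3, map_smul, LinearMap.smul_apply, bform_setVec]
      by_cases hU : k ∈ U
      · rw [h.c_setVec_of_mem hU, map_zero, if_neg, smul_zero]
        rintro rfl
        exact Finset.notMem_erase k T hU
      · by_cases hTU : T.erase k = U
        · subst hTU
          rw [h2, map_smul, bform_setVec, if_pos rfl, if_pos rfl]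
        · obtain ⟨δ, -, h5, -⟩ := h.exists_sign hU
          rw [h5, map_smul, bform_setVec, if_neg hTU, if_neg, smul_zero, smul_zero]
          rintro rfl
          exact hTU (Finset.erase_insert hU)
    · rw [h.a_setVec_of_notMem hT, map_zero, LinearMap.zero_apply]
      by_cases hU : k ∈ U
      · rw [h.c_setVec_of_mem hU, map_zero]
      · obtain ⟨δ, -, h5, -⟩ := h.exists_sign hU
        rw [h5, map_smul, bform_setVec, if_neg, smul_zero]
        rintro rfl
        exact hT (Finset.mem_insert_self k U)
  exact LinearMap.congr_fun (LinearMap.congr_fun this v) w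

lemma bform_c (h : IsFock a c Ω) (k : ι) (v w : M) : h.bform (c k v) w = h.bform v (a k w) := by
  rw [bform_comm, ← bform_a, bform_comm]

/-! ### Bivectors and the number operator -/

/-- The bivector operator `∑ j k, A j k • c_j a_k`. -/
noncomputable def bivector (a c : ι → Module.End ℂ M) (A : Matrix ι ι ℂ) : Module.End ℂ M :=
  ∑ j, ∑ k, A j k • (c j * a k)

lemma bivector_apply (A : Matrix ι ι ℂ) (v : M) :
    bivector a c A v = ∑ j, ∑ k, A j k • c j (a k v) := by
  simp [bivector, LinearMap.sum_apply]

lemma bivector_c (h : IsFock a c Ω) (A : Matrix ι ι ℂ) (l : ι) (v : M) :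
    bivector a c A (c l v) = c l (bivector a c A v) + ∑ j, A j l • c j v := by
  simp only [bivector_apply, h.a_c, map_sub, map_sum, map_smul, smul_sub, Finset.sum_sub_distrib]
  have h1 : ∀ j k : ι, c j (c l (a k v)) = -c l (c j (a k v)) := fun j k => h.c_c _ _ _
  simp only [h1, smul_neg, Finset.sum_neg_distrib, sub_neg_eq_add]
  rw [add_comm]
  congr 1
  refine Finset.sum_congr rfl fun j _ => ?_
  rw [Finset.sum_eq_single l] <;> simp +contextual

lemma bivector_a (h : IsFock a c Ω) (A : Matrix ι ι ℂ) (l : ι) (v : M) :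
    bivector a c A (a l v) = a l (bivector a c A v) - ∑ k, A l k • a k v := by
  simp only [bivector_apply, map_sum, map_smul, h.a_c, smul_sub, Finset.sum_sub_distrib]
  have h1 : ∀ j k : ι, c j (a l (a k v)) = -c j (a k (a l v)) := fun j k => by
    rw [h.a_a, map_neg]
  simp only [h1, smul_neg, Finset.sum_neg_distrib, sub_neg_eq_add]
  have h2 : ∑ j, ∑ k, A j k • (if l = j then a k v else 0) = ∑ k, A l k • a k v := by
    rw [Finset.sum_eq_single l]
    · simp
    · intro j _ hj
      simp [hj.symm]
    · simp
  rw [h2]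
  abel

lemma bform_bivector (h : IsFock a c Ω) (A : Matrix ι ι ℂ) (v w : M) :
    h.bform (bivector a c A v) w = h.bform v (bivector a c A.transpose w) := by
  simp only [bivector_apply, map_sum, map_smul, LinearMap.sum_apply, LinearMap.smul_apply,
    bform_c, bform_a, Matrix.transpose_apply]
  rw [Finset.sum_comm]

/-- The number operator `∑ k, c_k a_k`. -/
noncomputable def number (a c : ι → Module.End ℂ M) : Module.End ℂ M := bivector a c 1

lemma number_apply (v : M) : number a c v = ∑ k, c k (a k v) := by
  rw [number, bivector_apply]
  refine Finset.sum_congr rfl fun j _ => ?_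
  rw [Finset.sum_eq_single j] <;> simp +contextual [eq_comm]

lemma number_c (h : IsFock a c Ω) (l : ι) (v : M) :
    number a c (c l v) = c l (number a c v) + c l v := by
  rw [number, bivector_c h, Finset.sum_eq_single l] <;> simp +contextual

lemma number_a (h : IsFock a c Ω) (l : ι) (v : M) :
    number a c (a l v) = a l (number a c v) - a l v := by
  rw [number, bivector_a h, Finset.sum_eq_single l] <;>
    simp +contextual [eq_comm]

lemma number_bivector (h : IsFock a c Ω) (A : Matrix ι ι ℂ) (v : M) :
    number a c (bivector a c A v) = bivector a c A (number a c v) := by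
  simp only [bivector_apply, map_sum, map_smul, number_c h, number_a h, map_sub, sub_add_cancel]

lemma repr_number (h : IsFock a c Ω) (v : M) (T : Finset ι) :
    h.basis.repr (number a c v) T = T.card * h.basis.repr v T := by
  rw [number_apply, map_sum, Finsupp.finsetSum_apply]
  simp only [repr_c_a]
  rw [Finset.sum_ite_mem, Finset.univ_inter, Finset.sum_const, nsmul_eq_mul]

lemma number_listVec (h : IsFock a c Ω) (L : List ι) :
    number a c (listVec c Ω L) = (L.length : ℂ) • listVec c Ω L := by
  induction L with
  | nil =>
    change number a c Ω = _
    simp [number_apply, h.a_vac]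
  | cons k L ih =>
    change number a c (c k (listVec c Ω L)) = _ • c k (listVec c Ω L)
    rw [number_c h, ih, map_smul, List.length_cons, Nat.cast_succ, add_smul, one_smul]

lemma span_listVec (h : IsFock a c Ω) (t : ℕ) :
    Submodule.span ℂ (Set.range fun k : Fin t → ι => listVec c Ω (List.ofFn k)) =
      Module.End.eigenspace (number a c) (t : ℂ) := by
  apply le_antisymm
  · refine Submodule.span_le.2 ?_
    rintro _ ⟨k, rfl⟩
    have := h.number_listVec (List.ofFn k)
    rw [List.length_ofFn] at this
    exact Module.End.mem_eigenspace_iff.2 this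
  · intro v hv
    rw [Module.End.mem_eigenspace_iff] at hv
    rw [← h.basis.sum_repr v]
    refine Submodule.sum_mem _ fun T _ => ?_
    by_cases hT : h.basis.repr v T = 0
    · rw [hT, zero_smul]; exact Submodule.zero_mem _
    · have h1 := h.repr_number v T
      rw [hv, map_smul, Finsupp.smul_apply, smul_eq_mul] at h1
      -- A set with nonzero coefficient in a vector of degree `t` must have `t` elements.
      have h2 : t = T.toList.length := by
        rw [Finset.length_toList]; exact_mod_cast mul_right_cancel₀ hT h1
      subst h2
      refine Submodule.smul_mem _ _ (Submodule.subset_span ⟨T.toList.get, ?_⟩)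
      rw [h.basis_apply, setVec]
      exact congrArg _ (List.ofFn_get _)

end IsFock
end SymplecticSpinor

namespace SymplecticSpinor

/-! ### Symplectic Fock spaces -/

/-- The block description of `sp_{2p}(ℂ)`. -/
structure IsSymplecticMatrix {p : ℕ} (A : Matrix (Fin p ⊕ Fin p) (Fin p ⊕ Fin p) ℂ) : Prop where
  inr_inr : ∀ i j, A (.inr i) (.inr j) = -A (.inl j) (.inl i)
  inl_inr : ∀ i j, A (.inl i) (.inr j) = A (.inl j) (.inr i)
  inr_inl : ∀ i j, A (.inr i) (.inl j) = A (.inr j) (.inl i)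

lemma IsSymplecticMatrix.transpose {p : ℕ} {A : Matrix (Fin p ⊕ Fin p) (Fin p ⊕ Fin p) ℂ}
    (hA : IsSymplecticMatrix A) : IsSymplecticMatrix A.transpose where
  inr_inr i j := hA.inr_inr j i
  inl_inr i j := hA.inr_inl j i
  inr_inl i j := hA.inl_inr j i

set_option linter.unusedSectionVars false

namespace IsFock

variable {p : ℕ} {M : Type*} [AddCommGroup M] [Module ℂ M]
  {a c : Fin p ⊕ Fin p → Module.End ℂ M} {Ω : M}

/-- The lowering operator `∑ j, a_{2j} a_{2j-1}`. -/
def lower (a : Fin p ⊕ Fin p → Module.End ℂ M) : Module.End ℂ M :=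
  ∑ j : Fin p, a (.inr j) * a (.inl j)

/-- The raising operator `∑ j, c_{2j-1} c_{2j}`. -/
def raise (c : Fin p ⊕ Fin p → Module.End ℂ M) : Module.End ℂ M :=
  ∑ j : Fin p, c (.inl j) * c (.inr j)

lemma lower_apply (v : M) : lower a v = ∑ j, a (.inr j) (a (.inl j) v) := by
  simp [lower, LinearMap.sum_apply]

lemma raise_apply (v : M) : raise c v = ∑ j, c (.inl j) (c (.inr j) v) := by
  simp [raise, LinearMap.sum_apply]

lemma bform_lower (h : IsFock a c Ω) (v w : M) :
    h.bform (lower a v) w = h.bform v (raise c w) := by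
  simp only [lower_apply, raise_apply, map_sum, LinearMap.sum_apply, bform_a]

lemma sum_symm_smul_antisymm {κ : Type*} [Fintype κ] (s : κ → κ → ℂ) (g : κ → κ → M)
    (hs : ∀ i j, s i j = s j i) (hg : ∀ i j, g i j = -g j i) : ∑ i, ∑ j, s i j • g i j = 0 := by
  have h1 : ∑ i, ∑ j, s i j • g i j = -∑ i, ∑ j, s i j • g i j := by
    conv_lhs => rw [Finset.sum_comm]
    simp only [← Finset.sum_neg_distrib, ← smul_neg, ← hg]
    simp only [hs]
  rw [eq_neg_iff_add_eq_zero, ← two_smul ℂ] at h1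
  exact (smul_eq_zero.1 h1).resolve_left two_ne_zero

/-- Q is multiplication by the invariant symplectic bivector. In the commutator the symmetric
off-diagonal blocks meet antisymmetric products (`h1`, `h2`), and the two diagonal blocks cancel
(`h3`). -/
lemma raise_bivector (h : IsFock a c Ω) {A : Matrix (Fin p ⊕ Fin p) (Fin p ⊕ Fin p) ℂ}
    (hA : IsSymplecticMatrix A) (v : M) :
    raise c (bivector a c A v) = bivector a c A (raise c v) := by
  have h1 : ∑ m : Fin p, ∑ i : Fin p, A (.inr i) (.inl m) • c (.inr i) (c (.inr m) v) = 0 :=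
    sum_symm_smul_antisymm _ _ (fun i j => hA.inr_inl j i) fun i j => h.c_c _ _ _
  have h2 : ∑ m : Fin p, ∑ i : Fin p, A (.inl i) (.inr m) • c (.inl m) (c (.inl i) v) = 0 :=
    sum_symm_smul_antisymm _ _ (fun i j => hA.inl_inr j i) fun i j => h.c_c _ _ _
  have h3 : ∑ m : Fin p, ∑ i : Fin p, A (.inr i) (.inr m) • c (.inl m) (c (.inr i) v) =
      -∑ m : Fin p, ∑ i : Fin p, A (.inl i) (.inl m) • c (.inl i) (c (.inr m) v) := by
    conv_rhs => rw [Finset.sum_comm]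
    simp only [hA.inr_inr, neg_smul, Finset.sum_neg_distrib]
  simp only [raise_apply, map_sum, bivector_c h, map_add, map_smul, Finset.sum_add_distrib,
    Fintype.sum_sum_type]
  rw [h1, h2, h3]
  abel

/-- Adjoint of `raise_bivector`: symplectic matrices are stable under transpose. -/
lemma lower_bivector (h : IsFock a c Ω) {A : Matrix (Fin p ⊕ Fin p) (Fin p ⊕ Fin p) ℂ}
    (hA : IsSymplecticMatrix A) (v : M) :
    lower a (bivector a c A v) = bivector a c A (lower a v) := by
  refine h.eq_of_bform fun w => ?_
  rw [bform_lower, bform_bivector, bform_bivector, bform_lower, raise_bivector h hA.transpose]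

lemma lower_pow_bivector (h : IsFock a c Ω) {A : Matrix (Fin p ⊕ Fin p) (Fin p ⊕ Fin p) ℂ}
    (hA : IsSymplecticMatrix A) (k : ℕ) (v : M) :
    (lower a ^ k) (bivector a c A v) = bivector a c A ((lower a ^ k) v) := by
  induction k with
  | zero => rfl
  | succ k ih => rw [pow_succ', Module.End.mul_apply, Module.End.mul_apply, ih, lower_bivector h hA]

lemma number_lower (h : IsFock a c Ω) (v : M) :
    number a c (lower a v) = lower a (number a c v) - (2 : ℂ) • lower a v := by
  simp only [lower_apply, map_sum, number_a h, map_sub, Finset.smul_sum,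
    ← Finset.sum_sub_distrib, two_smul]
  exact Finset.sum_congr rfl fun j _ => by abel

lemma number_raise (h : IsFock a c Ω) (v : M) :
    number a c (raise c v) = raise c (number a c v) + (2 : ℂ) • raise c v := by
  simp only [raise_apply, map_sum, number_c h, map_add, Finset.smul_sum,
    ← Finset.sum_add_distrib, two_smul]
  exact Finset.sum_congr rfl fun j _ => by abel

/-! ### The commuting sl₂ and its strings -/

lemma raise_a_inl (h : IsFock a c Ω) (j : Fin p) (v : M) :
    raise c (a (.inl j) v) = a (.inl j) (raise c v) - c (.inr j) v := by
  simp only [raise_apply, map_sum, h.a_c, map_sub, apply_ite, map_zero]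
  simp only [Sum.inl.injEq, reduceCtorEq, if_false, zero_sub, sub_neg_eq_add,
    Finset.sum_add_distrib, Finset.sum_ite_eq, Finset.mem_univ, if_true]
  simp

lemma raise_a_inr (h : IsFock a c Ω) (j : Fin p) (v : M) :
    raise c (a (.inr j) v) = a (.inr j) (raise c v) + c (.inl j) v := by
  simp only [raise_apply, map_sum, h.a_c, map_sub, apply_ite, map_zero]
  simp only [Sum.inr.injEq, reduceCtorEq, if_false, zero_sub,
    Finset.sum_sub_distrib, Finset.sum_ite_eq, Finset.mem_univ, if_true, neg_sub]
  simp

lemma raise_lower (h : IsFock a c Ω) (v : M) :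
    raise c (lower a v) = lower a (raise c v) + (number a c v - (p : ℂ) • v) := by
  have h1 : (p : ℂ) • v = ∑ _j : Fin p, v := by
    rw [Finset.sum_const, Finset.card_univ, Fintype.card_fin, Nat.cast_smul_eq_nsmul]
  rw [h1, lower_apply v, map_sum, lower_apply, number_apply, Fintype.sum_sum_type,
    ← Finset.sum_add_distrib, ← Finset.sum_sub_distrib, ← Finset.sum_add_distrib]
  refine Finset.sum_congr rfl fun j _ => ?_
  rw [raise_a_inr h, raise_a_inl h, map_sub, h.a_c_self]
  abel

/-- The vectors of degree `2p - s` killed by the raising operator. -/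
noncomputable def primitive (a c : Fin p ⊕ Fin p → Module.End ℂ M) (s : ℕ) : Submodule ℂ M :=
  LinearMap.ker (raise c) ⊓ Module.End.eigenspace (number a c) ((2 * p - s : ℕ) : ℂ)

lemma mem_primitive {s : ℕ} (hs : s ≤ p) {v : M} :
    v ∈ primitive a c s ↔ raise c v = 0 ∧ number a c v = (2 * p - s : ℂ) • v := by
  rw [primitive, Submodule.mem_inf, LinearMap.mem_ker, Module.End.mem_eigenspace_iff,
    Nat.cast_sub (by omega), Nat.cast_mul, Nat.cast_ofNat]

lemma number_lower_pow (h : IsFock a c Ω) {t : ℂ} {v : M} (hv : number a c v = t • v) (k : ℕ) :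
    number a c ((lower a ^ k) v) = (t - 2 * k) • (lower a ^ k) v := by
  induction k with
  | zero => simpa using hv
  | succ k ih =>
    rw [pow_succ', Module.End.mul_apply, number_lower h, ih, map_smul, ← sub_smul]
    congr 1
    push_cast
    ring

/-- Moving Q past each P contributes N - p; the coefficient is the sum of p - s - 2i over i = 0, …,
k. -/
lemma raise_lower_pow (h : IsFock a c Ω) {s : ℕ} (hs : s ≤ p) {v : M} (hv : v ∈ primitive a c s)
    (k : ℕ) : raise c ((lower a ^ (k + 1)) v) =
      ((k + 1) * (p - s - k) : ℂ) • (lower a ^ k) v := by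
  obtain ⟨h1, h2⟩ := (mem_primitive hs).1 hv
  induction k with
  | zero =>
    rw [zero_add, pow_one, raise_lower h, h1, h2, map_zero, zero_add, ← sub_smul, pow_zero,
      Module.End.one_apply]
    congr 1
    push_cast
    ring
  | succ k ih =>
    rw [pow_succ', Module.End.mul_apply, raise_lower h, ih, number_lower_pow h h2, map_smul,
      ← Module.End.mul_apply, ← pow_succ', ← sub_smul, ← add_smul]
    congr 1
    push_cast
    ring

lemma lower_pow_ne_zero (h : IsFock a c Ω) {s : ℕ} (hs : s ≤ p) {v : M}
    (hv : v ∈ primitive a c s) (hv0 : v ≠ 0) {k : ℕ} (hk : k ≤ p - s) : (lower a ^ k) v ≠ 0 := by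
  induction k with
  | zero => simpa using hv0
  | succ k ih =>
    intro h0
    have h1 := raise_lower_pow h hs hv k
    rw [h0, map_zero] at h1
    refine smul_ne_zero (mul_ne_zero (Nat.cast_add_one_ne_zero k) ?_) (ih (by omega)) h1.symm
    rw [sub_sub, sub_ne_zero]
    exact_mod_cast (show p ≠ s + k by omega)

/-! ### The decomposition of the homogeneous components -/

lemma lower_raise_lower_pow (h : IsFock a c Ω) {s : ℕ} (hs : s ≤ p) {v : M}
    (hv : v ∈ primitive a c s) (k : ℕ) :
    lower a (raise c ((lower a ^ k) v)) = (k * (p - s - k + 1) : ℂ) • (lower a ^ k) v := by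
  cases k with
  | zero => simp [((mem_primitive hs).1 hv).1]
  | succ k =>
    rw [raise_lower_pow h hs hv, map_smul, ← Module.End.mul_apply, ← pow_succ']
    congr 1
    push_cast
    ring

/-- The j-th summand lies in the eigenspace of PQ for j(p - r + j + 1), which is strictly increasing
in j. -/
lemma iSupIndep_map_lower_pow (h : IsFock a c Ω) {r : ℕ} (hr : r ≤ p) :
    iSupIndep (fun j : Fin (r / 2 + 1) =>
      (primitive a c (r - 2 * (j : ℕ))).map (lower a ^ (j : ℕ))) := by
  let μ : Fin (r / 2 + 1) → ℂ := fun j => ((j * (p - r + j + 1) : ℕ) : ℂ)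
  have hμ : Function.Injective μ := by
    intro i j hij
    have h1 : (i : ℕ) * (p - r + i + 1) = j * (p - r + j + 1) :=
      Nat.cast_injective (R := ℂ) hij
    by_contra hne
    rcases lt_or_gt_of_ne (fun h2 => hne (Fin.ext h2) : (i : ℕ) ≠ j) with h2 | h2
    · exact (Nat.mul_lt_mul_of_lt_of_le h2 (by omega) (by omega)).ne h1
    · exact (Nat.mul_lt_mul_of_lt_of_le h2 (by omega) (by omega)).ne' h1
  refine ((Module.End.eigenspaces_iSupIndep (lower a * raise c)).comp hμ).mono fun j => ?_
  rintro _ ⟨v, hv, rfl⟩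
  have hj : 2 * (j : ℕ) ≤ r := by omega
  rw [Function.comp_apply, Module.End.mem_eigenspace_iff, Module.End.mul_apply,
    lower_raise_lower_pow h (by omega) hv]
  congr 1
  simp only [μ]
  push_cast [Nat.cast_sub hr, Nat.cast_sub hj]
  ring

/-- Qv has degree 2p - (r - 2), so by induction it decomposes; Q can be inverted on each string,
giving w of the same degree as v with Qw = Qv. Then v - w is killed by Q and forms the summand j =
0. -/
lemma mem_iSup_map_lower_pow (h : IsFock a c Ω) {r : ℕ} (hr : r ≤ p) {v : M}
    (hv : number a c v = (2 * p - r : ℂ) • v) :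
    v ∈ ⨆ j : Fin (r / 2 + 1), (primitive a c (r - 2 * (j : ℕ))).map (lower a ^ (j : ℕ)) := by
  induction r using Nat.strong_induction_on generalizing v with
  | _ r ih =>
  have hprim : ∀ w ∈ primitive a c r,
      w ∈ ⨆ j : Fin (r / 2 + 1), (primitive a c (r - 2 * (j : ℕ))).map (lower a ^ (j : ℕ)) :=
    fun w hw => Submodule.mem_iSup_of_mem 0 ⟨w, by simpa using hw, by simp⟩
  have hraise : number a c (raise c v) = (2 * p - r + 2 : ℂ) • raise c v := by
    rw [number_raise h, hv, map_smul, ← add_smul]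
  obtain ⟨w, hw, hw2⟩ : ∃ w ∈ ⨆ j : Fin (r / 2 + 1),
      (primitive a c (r - 2 * (j : ℕ))).map (lower a ^ (j : ℕ)), raise c w = raise c v ∧
        number a c w = (2 * p - r : ℂ) • w := by
    by_cases h2 : 2 ≤ r
    · have h3 := ih (r - 2) (by omega) (by omega) (v := raise c v) (by
        rw [hraise]; congr 1; push_cast [Nat.cast_sub h2]; ring)
      rw [Submodule.mem_iSup_iff_exists_finsupp] at h3
      obtain ⟨g, hg, hsum⟩ := h3
      choose y hy hyg using hg
      have hdeg : ∀ j : Fin ((r - 2) / 2 + 1), ((p : ℂ) - (r - 2 - 2 * (j : ℕ) : ℕ) - (j : ℕ)) =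
          ((p - r + 2 + j : ℕ) : ℂ) := by
        intro j
        have : 2 * (j : ℕ) ≤ r - 2 := by omega
        push_cast [Nat.cast_sub this, Nat.cast_sub h2, Nat.cast_sub hr]
        ring
      -- The coefficient of `raise_lower_pow` for s = r - 2 - 2j and k = j; it is nonzero because r
      -- ≤ p.
      let d : Fin ((r - 2) / 2 + 1) → ℂ := fun j => (((j + 1) * (p - r + 2 + j) : ℕ) : ℂ)
      have hd : ∀ j, d j ≠ 0 := fun j => by
        simp only [d]
        exact_mod_cast (Nat.mul_pos (by omega) (by omega)).ne'
      refine ⟨∑ j, (d j)⁻¹ • (lower a ^ ((j : ℕ) + 1)) (y j), ?_, ?_, ?_⟩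
      · refine Submodule.sum_mem _ fun j _ => Submodule.smul_mem _ _ ?_
        refine Submodule.mem_iSup_of_mem ⟨j + 1, by omega⟩ ⟨y j, ?_, rfl⟩
        have h4 := hy j
        rwa [show r - 2 - 2 * (j : ℕ) = r - 2 * ((j : ℕ) + 1) by omega] at h4
      · rw [← hsum, map_sum, Finsupp.sum_fintype _ _ (fun _ => rfl)]
        refine Finset.sum_congr rfl fun j _ => ?_
        rw [map_smul, raise_lower_pow h (by omega) (hy j), hdeg, smul_smul, ← hyg]
        rw [show (((j : ℕ) : ℂ) + 1) * ((p - r + 2 + j : ℕ) : ℂ) = d j by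
          simp only [d]; push_cast; rfl, inv_mul_cancel₀ (hd j), one_smul]
      · rw [map_sum, Finset.smul_sum]
        refine Finset.sum_congr rfl fun j _ => ?_
        have hj : 2 * (j : ℕ) ≤ r - 2 := by omega
        rw [map_smul, number_lower_pow h ((mem_primitive (by omega)).1 (hy j)).2, smul_comm]
        congr 1
        push_cast [Nat.cast_sub hj, Nat.cast_sub h2]
        ring
    -- For r ≤ 1 the degree 2p - r + 2 of Qv exceeds the number 2p of indices, so Qv = 0.
    · refine ⟨0, Submodule.zero_mem _, ?_, by simp⟩
      rw [map_zero]
      refine (h.basis.repr.map_eq_zero_iff.1 (Finsupp.ext fun T => ?_)).symm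
      have h3 := h.repr_number (raise c v) T
      rw [hraise, map_smul, Finsupp.smul_apply, smul_eq_mul, ← sub_eq_zero, ← sub_mul,
        mul_eq_zero] at h3
      refine h3.resolve_left fun h4 => ?_
      have h5 : (2 * p + 2 : ℂ) = ((T.card + r : ℕ) : ℂ) := by
        push_cast; linear_combination h4
      have h6 : 2 * p + 2 = T.card + r := by exact_mod_cast h5
      have h7 := Finset.card_le_univ T
      simp only [Fintype.card_sum, Fintype.card_fin] at h7
      omega
  rw [← sub_add_cancel v w]
  refine Submodule.add_mem _ (hprim _ ?_) hw
  rw [mem_primitive hr, map_sub, map_sub, hw2.1, hw2.2, hv, sub_self, smul_sub]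
  exact ⟨rfl, rfl⟩

lemma iSup_map_lower_pow (h : IsFock a c Ω) {r : ℕ} (hr : r ≤ p) :
    ⨆ j : Fin (r / 2 + 1), (primitive a c (r - 2 * (j : ℕ))).map (lower a ^ (j : ℕ)) =
      Module.End.eigenspace (number a c) ((2 * p - r : ℕ) : ℂ) := by
  have hcast : ((2 * p - r : ℕ) : ℂ) = 2 * p - r := by
    push_cast [Nat.cast_sub (show r ≤ 2 * p by omega)]; rfl
  apply le_antisymm
  · refine iSup_le fun j => ?_
    rintro _ ⟨v, hv, rfl⟩
    have hj : 2 * (j : ℕ) ≤ r := by omega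
    rw [Module.End.mem_eigenspace_iff, hcast,
      number_lower_pow h ((mem_primitive (by omega)).1 hv).2]
    congr 1
    push_cast [Nat.cast_sub hj]
    ring
  · intro v hv
    rw [Module.End.mem_eigenspace_iff, hcast] at hv
    exact mem_iSup_map_lower_pow h hr hv

end IsFock
end SymplecticSpinor

namespace SymplecticSpinor

set_option linter.unusedSectionVars false

namespace IsFock

variable {p : ℕ} {M : Type*} [AddCommGroup M] [Module ℂ M]
  {a c : Fin p ⊕ Fin p → Module.End ℂ M} {Ω : M}

/-! ### Highest weight vectors -/

/-- The root operator `c_{2i-1} a_{2j-1} - c_{2j} a_{2i}`. -/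
def shortRoot (a c : Fin p ⊕ Fin p → Module.End ℂ M) (i j : Fin p) : Module.End ℂ M :=
  c (.inl i) * a (.inl j) - c (.inr j) * a (.inr i)

/-- The root operator `c_{2i-1} a_{2i}`. -/
def longRoot (a c : Fin p ⊕ Fin p → Module.End ℂ M) (i : Fin p) : Module.End ℂ M :=
  c (.inl i) * a (.inr i)

lemma bivector_single (i j : Fin p ⊕ Fin p) :
    bivector a c (Matrix.single i j 1) = c i * a j := by
  rw [bivector, Finset.sum_eq_single i, Finset.sum_eq_single j]
  · simp
  · intro k _ hk
    simp [hk.symm]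
  · simp
  · intro k _ hk
    refine Finset.sum_eq_zero fun l _ => ?_
    simp [hk.symm]
  · simp

lemma bivector_sub (A B : Matrix (Fin p ⊕ Fin p) (Fin p ⊕ Fin p) ℂ) :
    bivector a c (A - B) = bivector a c A - bivector a c B := by
  simp [bivector, sub_smul]

lemma isSymplecticMatrix_single (i : Fin p) :
    IsSymplecticMatrix (Matrix.single (.inl i) (.inr i) (1 : ℂ)) where
  inr_inr _ _ := by simp
  inl_inr _ _ := by simp [Matrix.single_apply, and_comm]
  inr_inl _ _ := by simp

lemma isSymplecticMatrix_single_sub (i j : Fin p) :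
    IsSymplecticMatrix
      (Matrix.single (.inl i) (.inl j) (1 : ℂ) - Matrix.single (.inr j) (.inr i) 1) where
  inr_inr _ _ := by simp [Matrix.single_apply, and_comm]
  inl_inr _ _ := by simp
  inr_inl _ _ := by simp

/-- The strictly dominant diagonal entries `p, p - 1, …, 1, -p, …, -1`. -/
def dominant (p : ℕ) : Fin p ⊕ Fin p → ℂ :=
  Sum.elim (fun i => (p : ℂ) - (i : ℕ)) fun i => (i : ℕ) - (p : ℂ)

lemma isSymplecticMatrix_dominant (p : ℕ) :
    IsSymplecticMatrix (Matrix.diagonal (dominant p)) where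
  inr_inr i j := by
    by_cases hij : i = j
    · subst hij; simp [dominant]
    · simp [hij, Ne.symm hij]
  inl_inr _ _ := by simp
  inr_inl _ _ := by simp

lemma bivector_diagonal_c (h : IsFock a c Ω) (d : Fin p ⊕ Fin p → ℂ) (l : Fin p ⊕ Fin p) (v : M) :
    bivector a c (Matrix.diagonal d) (c l v) =
      c l (bivector a c (Matrix.diagonal d) v) + d l • c l v := by
  rw [bivector_c h, Finset.sum_eq_single l] <;> simp +contextual

lemma bivector_diagonal_a (h : IsFock a c Ω) (d : Fin p ⊕ Fin p → ℂ) (l : Fin p ⊕ Fin p) (v : M) :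
    bivector a c (Matrix.diagonal d) (a l v) =
      a l (bivector a c (Matrix.diagonal d) v) - d l • a l v := by
  rw [bivector_a h, Finset.sum_eq_single l] <;> simp +contextual [eq_comm]

lemma bivector_diagonal_c_a (h : IsFock a c Ω) {d : Fin p ⊕ Fin p → ℂ} {μ : ℂ} {v : M}
    (hv : bivector a c (Matrix.diagonal d) v = μ • v) (k l : Fin p ⊕ Fin p) :
    bivector a c (Matrix.diagonal d) (c k (a l v)) = (μ + (d k - d l)) • c k (a l v) := by
  rw [bivector_diagonal_c h, bivector_diagonal_a h, hv, map_sub, map_smul, map_smul, map_smul]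
  module

/-- An eigenvector in `N` of a strictly dominant Cartan element, with eigenvalue of maximal real
part: a positive root operator would raise the real part, so it kills the vector. -/
lemma exists_highest (h : IsFock a c Ω) {N : Submodule ℂ M} (hN0 : N ≠ ⊥)
    (hN : ∀ A, IsSymplecticMatrix A → ∀ v ∈ N, bivector a c A v ∈ N) :
    ∃ v ∈ N, v ≠ 0 ∧ (∀ i, longRoot a c i v = 0) ∧
      ∀ i j, i < j → shortRoot a c i j v = 0 := by
  have := h.finite
  have : Nontrivial N := Submodule.nontrivial_iff_ne_bot.2 hN0
  let D : Module.End ℂ N := (bivector a c (Matrix.diagonal (dominant p))).restrict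
    (hN _ (isSymplecticMatrix_dominant p))
  obtain ⟨μ0, hμ0⟩ := Module.End.exists_eigenvalue D
  have hfin : {μ | D.HasEigenvalue μ}.Finite := by
    refine (Module.End.finite_spectrum D).subset fun μ hμ => ?_
    exact Module.End.HasEigenvalue.mem_spectrum hμ
  obtain ⟨μ, hμ, hmax⟩ := Set.exists_max_image _ Complex.re hfin ⟨μ0, hμ0⟩
  obtain ⟨⟨v, hvN⟩, hv1, hv0⟩ := hμ.exists_hasEigenvector
  rw [Module.End.mem_eigenspace_iff] at hv1
  have hv : bivector a c (Matrix.diagonal (dominant p)) v = μ • v := congrArg Subtype.val hv1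
  have key : ∀ w ∈ N, ∀ x : ℂ, 0 < x.re →
      bivector a c (Matrix.diagonal (dominant p)) w = (μ + x) • w → w = 0 := by
    intro w hw x hx hwx
    by_contra hw0
    have h1 : D.HasEigenvalue (μ + x) := Module.End.hasEigenvalue_of_hasEigenvector
      (x := ⟨w, hw⟩) ⟨Module.End.mem_eigenspace_iff.2 (Subtype.ext hwx),
        fun h0 => hw0 (congrArg Subtype.val h0)⟩
    have h2 := hmax _ h1
    rw [Complex.add_re] at h2
    linarith
  refine ⟨v, hvN, fun h0 => hv0 (Subtype.ext h0), fun i => ?_, fun i j hij => ?_⟩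
  -- The value of the root on the dominant element: 2(p - i) for a long root, and j - i for a short
  -- root below.
  · refine key _ ?_ (2 * (p - i : ℝ) : ℝ) ?_ ?_
    · rw [longRoot, ← bivector_single]
      exact hN _ (isSymplecticMatrix_single i) _ hvN
    · have : (i : ℝ) < p := by exact_mod_cast i.2
      rw [Complex.ofReal_re]
      linarith
    · rw [longRoot, Module.End.mul_apply, bivector_diagonal_c_a h hv]
      congr 2
      simp only [dominant, Sum.elim_inl, Sum.elim_inr]
      push_cast
      ring
  · refine key _ ?_ ((j : ℝ) - i : ℝ) ?_ ?_
    · rw [shortRoot, ← bivector_single, ← bivector_single, ← bivector_sub]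
      exact hN _ (isSymplecticMatrix_single_sub i j) _ hvN
    · rw [Complex.ofReal_re, sub_pos]
      exact_mod_cast hij
    · rw [shortRoot, LinearMap.sub_apply, Module.End.mul_apply, Module.End.mul_apply, map_sub,
        bivector_diagonal_c_a h hv, bivector_diagonal_c_a h hv, smul_sub]
      congr 3 <;>
      · simp only [dominant, Sum.elim_inl, Sum.elim_inr]
        push_cast
        ring

/-! ### Highest weight equations in terms of number operators -/

lemma c_a_c_a_of_ne (h : IsFock a c Ω) {j k : Fin p ⊕ Fin p} (hjk : j ≠ k) (v : M) :
    c j (c k (a k (a j v))) = c k (a k (c j (a j v))) := by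
  rw [h.c_c, h.c_a_of_ne hjk, map_neg, neg_neg]

lemma c_a_c_a_eq_sub (h : IsFock a c Ω) {j k : Fin p ⊕ Fin p} (hjk : j ≠ k) (v : M) :
    c j (a k (c k (a j v))) = c j (a j v) - c k (a k (c j (a j v))) := by
  rw [h.a_c_self, map_sub, c_a_c_a_of_ne h hjk]

/-- With n_k = c_k a_k this reads n_{2i} v = n_{2i-1} n_{2i} v: a set occurring in v that contains
2i also contains 2i - 1. -/
lemma c_a_of_longRoot (h : IsFock a c Ω) {v : M} {i : Fin p} (hv : longRoot a c i v = 0) :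
    c (.inr i) (a (.inr i) v) = c (.inl i) (a (.inl i) (c (.inr i) (a (.inr i) v))) := by
  have h1 := c_a_c_a_eq_sub h (Sum.inr_ne_inl : (.inr i : Fin p ⊕ Fin p) ≠ .inl i) v
  rw [longRoot, Module.End.mul_apply] at hv
  rw [hv, map_zero, map_zero] at h1
  exact sub_eq_zero.1 h1.symm

/-- The short root equation trades a non-diagonal quartic term of PQ type for the diagonal operator
n_{2j-1}(1 - n_{2i-1}), whose effect on coefficients is explicit. -/
lemma c_c_a_a_of_shortRoot_inl (h : IsFock a c Ω) {v : M} {i j : Fin p} (hij : i < j)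
    (hv : shortRoot a c i j v = 0) :
    c (.inl j) (c (.inr j) (a (.inr i) (a (.inl i) v))) =
      c (.inl j) (a (.inl j) v) - c (.inl i) (a (.inl i) (c (.inl j) (a (.inl j) v))) := by
  have hne : (.inl j : Fin p ⊕ Fin p) ≠ .inl i := by simpa using hij.ne'
  rw [shortRoot, LinearMap.sub_apply, Module.End.mul_apply, Module.End.mul_apply, sub_eq_zero] at hv
  rw [← c_a_c_a_eq_sub h hne, hv, h.a_c_of_ne Sum.inl_ne_inr, h.a_a (.inl i), map_neg, map_neg,
    map_neg, neg_neg]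

lemma c_c_a_a_of_shortRoot_inr (h : IsFock a c Ω) {v : M} {i j : Fin p} (hij : i < j)
    (hv : shortRoot a c i j v = 0) :
    c (.inl i) (c (.inr i) (a (.inr j) (a (.inl j) v))) =
      c (.inr i) (a (.inr i) v) - c (.inr j) (a (.inr j) (c (.inr i) (a (.inr i) v))) := by
  have hne : (.inr i : Fin p ⊕ Fin p) ≠ .inr j := by simpa using hij.ne
  rw [shortRoot, LinearMap.sub_apply, Module.End.mul_apply, Module.End.mul_apply, sub_eq_zero] at hv
  rw [← c_a_c_a_eq_sub h hne, ← hv, h.a_c_of_ne Sum.inr_ne_inl, map_neg, h.c_c]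

/-- The right side is the product (1 - n_{2j-1})(1 - n_{2j}), expanded. -/
lemma a_a_c_c_self (h : IsFock a c Ω) (j : Fin p) (v : M) :
    a (.inr j) (a (.inl j) (c (.inl j) (c (.inr j) v))) =
      v - c (.inr j) (a (.inr j) v) - (c (.inl j) (a (.inl j) v) -
        c (.inr j) (a (.inr j) (c (.inl j) (a (.inl j) v)))) := by
  have h1 : (.inr j : Fin p ⊕ Fin p) ≠ .inl j := Sum.inr_ne_inl
  rw [h.a_c_self, map_sub, h.a_c_self, h.a_c_of_ne h1, h.a_c_of_ne h1.symm, map_neg, map_neg,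
    h.a_c_self, map_sub, c_a_c_a_of_ne h h1.symm]
  abel

lemma a_a_c_c_of_ne (h : IsFock a c Ω) {i j : Fin p} (hij : i ≠ j) (v : M) :
    a (.inr j) (a (.inl j) (c (.inl i) (c (.inr i) v))) =
      c (.inl i) (c (.inr i) (a (.inr j) (a (.inl j) v))) := by
  have h1 : (.inl j : Fin p ⊕ Fin p) ≠ .inl i := by simpa using hij.symm
  have h2 : (.inr j : Fin p ⊕ Fin p) ≠ .inr i := by simpa using hij.symm
  rw [h.a_c_of_ne h1, h.a_c_of_ne Sum.inl_ne_inr, map_neg, map_neg, map_neg, neg_neg,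
    h.a_c_of_ne Sum.inr_ne_inl,
    h.a_c_of_ne h2, map_neg, neg_neg]

/-- The set of indices of the highest weight vector of weight `(1_r)`. -/
def highestSet (p r : ℕ) : Finset (Fin p ⊕ Fin p) :=
  Finset.univ.disjSum (Finset.univ.filter fun i : Fin p => r ≤ (i : ℕ))

lemma card_filter_le (p r : ℕ) :
    (Finset.univ.filter fun i : Fin p => r ≤ (i : ℕ)).card = p - r := by
  rw [← Finset.card_map Fin.valEmbedding, ← Nat.card_Ico]
  congr 1
  ext x
  simp only [Finset.mem_map, Finset.mem_filter, Finset.mem_univ, true_and, Fin.valEmbedding_apply,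
    Finset.mem_Ico]
  exact ⟨fun ⟨i, hi, hx⟩ => hx ▸ ⟨hi, i.2⟩, fun hx => ⟨⟨x, hx.2⟩, hx.1, rfl⟩⟩

lemma card_highestSet {r : ℕ} (hr : r ≤ p) : (highestSet p r).card = 2 * p - r := by
  rw [highestSet, Finset.card_disjSum, card_filter_le, Finset.card_univ, Fintype.card_fin]
  omega

lemma eq_highestSet {r : ℕ} (hr : r ≤ p) {T : Finset (Fin p ⊕ Fin p)} (hT : T.card = 2 * p - r)
    (hl : ∀ i, .inl i ∈ T) (hup : ∀ i j : Fin p, i < j → .inr i ∈ T → .inr j ∈ T) :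
    T = highestSet p r := by
  -- The even part of `T` is closed upwards, so it is comparable with the final segment starting at
  -- `r`; equal cardinalities then force equality.
  by_cases hsub : ∀ i : Fin p, .inr i ∈ T → r ≤ (i : ℕ)
  · refine Finset.eq_of_subset_of_card_le ?_ (by rw [hT, card_highestSet hr])
    rintro (i | i) hi
    · simp [highestSet]
    · simpa [highestSet] using hsub i hi
  · push Not at hsub
    obtain ⟨i, hi, hir⟩ := hsub
    refine (Finset.eq_of_subset_of_card_le ?_ (by rw [hT, card_highestSet hr])).symm
    rintro (j | j) hj
    · exact hl j
    · have hj2 : r ≤ (j : ℕ) := by simpa [highestSet] using hj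
      exact hup i j (Fin.lt_def.2 (by omega)) hi

/-- If `T` misses 2j - 1 it misses 2j too. Applying a_{2j} a_{2j-1} to Qv = 0 and reading off the
coefficient at `T` gives that coefficient times a sum of zeros and ones whose term i = j is 1. No
cancellation is possible, so the coefficient is 0. -/
lemma inl_mem_of_highest (h : IsFock a c Ω) {v : M} (hlong : ∀ i, longRoot a c i v = 0)
    (hshort : ∀ i j, i < j → shortRoot a c i j v = 0) (hv : raise c v = 0)
    {T : Finset (Fin p ⊕ Fin p)} (hT : h.basis.repr v T ≠ 0) (j : Fin p) : .inl j ∈ T := by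
  by_contra hj
  have hj2 : (.inr j : Fin p ⊕ Fin p) ∉ T := by
    intro hmem
    have h1 := congrArg (fun w => h.basis.repr w T) (c_a_of_longRoot h (hlong j))
    simp only [repr_c_a, if_pos hmem, if_neg hj] at h1
    exact hT h1
  have h1 : ∀ i : Fin p,
      h.basis.repr (a (.inr j) (a (.inl j) (c (.inl i) (c (.inr i) v)))) T =
        ((if i = j then 1 else if i < j then (if .inr i ∈ T then 1 else 0) else
          (if .inl i ∈ T then 1 else 0) : ℕ) : ℂ) * h.basis.repr v T := by
    intro i
    rcases lt_trichotomy i j with hij | hij | hij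
    · rw [a_a_c_c_of_ne h hij.ne, c_c_a_a_of_shortRoot_inr h hij (hshort i j hij)]
      simp only [map_sub, Finsupp.sub_apply, repr_c_a, if_neg hj2, if_neg hij.ne, if_pos hij]
      split_ifs <;> simp
    · subst hij
      rw [a_a_c_c_self h]
      simp [repr_c_a, hj, hj2]
    · rw [a_a_c_c_of_ne h hij.ne', c_c_a_a_of_shortRoot_inl h hij (hshort j i hij)]
      simp only [map_sub, Finsupp.sub_apply, repr_c_a, if_neg hj, if_neg hij.ne', if_neg hij.not_gt]
      split_ifs <;> simp
  have h2 := congrArg (fun w => h.basis.repr (a (.inr j) (a (.inl j) w)) T) hv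
  simp only [raise_apply, map_sum, Finsupp.finsetSum_apply, h1, map_zero, Finsupp.zero_apply,
    ← Finset.sum_mul, ← Nat.cast_sum] at h2
  have h3 := (mul_eq_zero.1 h2).resolve_right hT
  rw [Nat.cast_eq_zero, Finset.sum_eq_zero_iff] at h3
  simpa using h3 j (Finset.mem_univ j)

/-- All odd indices are present in `T`, hence every odd creation operator kills v and the short root
equation reduces to c_{2j} a_{2i} v = 0. This makes the even part closed upwards; the degree fixes
its size. -/
lemma eq_highestSet_of_highest (h : IsFock a c Ω) {r : ℕ} (hr : r ≤ p) {v : M}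
    (hlong : ∀ i, longRoot a c i v = 0) (hshort : ∀ i j, i < j → shortRoot a c i j v = 0)
    (hv : v ∈ primitive a c r) {T : Finset (Fin p ⊕ Fin p)} (hT : h.basis.repr v T ≠ 0) :
    T = highestSet p r := by
  obtain ⟨h1, h2⟩ := (mem_primitive hr).1 hv
  have hcl : ∀ j, c (.inl j) v = 0 := by
    intro j
    have h3 : c (.inl j) (a (.inl j) v) = v := by
      refine h.basis.repr.injective (Finsupp.ext fun U => ?_)
      rw [repr_c_a]
      by_cases hU : h.basis.repr v U = 0
      · simp [hU]
      · rw [if_pos (inl_mem_of_highest h hlong hshort h1 hU j)]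
    rw [← h3, h.c_c_self]
  refine eq_highestSet hr ?_ (inl_mem_of_highest h hlong hshort h1 hT) fun i j hij hi => ?_
  · have h3 := h.repr_number v T
    rw [h2, map_smul, Finsupp.smul_apply, smul_eq_mul] at h3
    have h4 := mul_right_cancel₀ hT h3
    have h5 : (2 * p : ℂ) = ((T.card + r : ℕ) : ℂ) := by push_cast; linear_combination h4
    have h6 : 2 * p = T.card + r := by exact_mod_cast h5
    omega
  · by_contra hj
    have hne : (.inl i : Fin p ⊕ Fin p) ≠ .inl j := by simpa using hij.ne
    have hne2 : (.inr i : Fin p ⊕ Fin p) ≠ .inr j := by simpa using hij.ne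
    have h3 := hshort i j hij
    rw [shortRoot, LinearMap.sub_apply, Module.End.mul_apply, Module.End.mul_apply,
      h.c_a_of_ne hne, hcl, map_zero, neg_zero, zero_sub, neg_eq_zero] at h3
    have h4 := c_a_c_a_eq_sub h hne2 v
    rw [h3, map_zero, map_zero] at h4
    have h5 := congrArg (fun w => h.basis.repr w T) h4
    simp only [map_zero, Finsupp.zero_apply, map_sub, Finsupp.sub_apply, repr_c_a, if_pos hi,
      if_neg hj, sub_zero] at h5
    exact hT h5.symm

lemma setVec_highestSet_mem_primitive (h : IsFock a c Ω) {r : ℕ} (hr : r ≤ p) :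
    setVec c Ω (highestSet p r) ∈ primitive a c r := by
  rw [primitive, Submodule.mem_inf, LinearMap.mem_ker, Module.End.mem_eigenspace_iff]
  constructor
  · rw [raise_apply]
    refine Finset.sum_eq_zero fun j _ => ?_
    rw [h.c_c, h.c_setVec_of_mem (by simp [highestSet]), map_zero, neg_zero]
  · rw [setVec, number_listVec h, Finset.length_toList, card_highestSet hr]

lemma setVec_highestSet_mem (h : IsFock a c Ω) {r : ℕ} (hr : r ≤ p) {N : Submodule ℂ M}
    (hNK : N ≤ primitive a c r) (hN0 : N ≠ ⊥)
    (hN : ∀ A, IsSymplecticMatrix A → ∀ v ∈ N, bivector a c A v ∈ N) :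
    setVec c Ω (highestSet p r) ∈ N := by
  obtain ⟨v, hvN, hv0, hlong, hshort⟩ := exists_highest h hN0 hN
  have h1 : v = h.basis.repr v (highestSet p r) • setVec c Ω (highestSet p r) := by
    conv_lhs => rw [← h.basis.sum_repr v]
    rw [Finset.sum_eq_single (highestSet p r), basis_apply]
    · intro T _ hT
      rw [not_imp_comm.1 (eq_highestSet_of_highest h hr hlong hshort (hNK hvN)) hT, zero_smul]
    · simp
  have h2 : h.basis.repr v (highestSet p r) ≠ 0 := by
    intro h0
    rw [h0, zero_smul] at h1
    exact hv0 h1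
  rw [h1] at hvN
  exact (Submodule.smul_mem_iff N h2).1 hvN

/-! ### Irreducibility of the cells -/

lemma bivector_mem_primitive (h : IsFock a c Ω) {r : ℕ}
    {A : Matrix (Fin p ⊕ Fin p) (Fin p ⊕ Fin p) ℂ} (hA : IsSymplecticMatrix A) {v : M}
    (hv : v ∈ primitive a c r) : bivector a c A v ∈ primitive a c r := by
  rw [primitive, Submodule.mem_inf, LinearMap.mem_ker, Module.End.mem_eigenspace_iff] at hv ⊢
  rw [raise_bivector h hA, hv.1, map_zero, number_bivector h, hv.2, map_smul]
  exact ⟨rfl, rfl⟩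

lemma eq_primitive_of_invariant (h : IsFock a c Ω) {r : ℕ} (hr : r ≤ p) {N : Submodule ℂ M}
    (hNK : N ≤ primitive a c r) (hN0 : N ≠ ⊥)
    (hN : ∀ A, IsSymplecticMatrix A → ∀ v ∈ N, bivector a c A v ∈ N) :
    N = primitive a c r := by
  have := h.finite
  -- The orthogonal of `N` inside the cell. The form is bilinear over ℂ, so isotropic vectors exist
  -- and complementarity is not automatic; `N' = ⊥` comes from the highest vector, and then the cell
  -- embeds in the dual of `N`.
  let N' : Submodule ℂ M := primitive a c r ⊓ ⨅ w : N, LinearMap.ker (h.bform w)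
  have hmem : ∀ v, v ∈ N' ↔ v ∈ primitive a c r ∧ ∀ w ∈ N, h.bform w v = 0 := by
    intro v
    simp [N', Submodule.mem_inf, Submodule.mem_iInf]
  have hN' : N' = ⊥ := by
    by_contra hne
    have h1 := setVec_highestSet_mem h hr (N := N') inf_le_left hne fun A hA v hv => by
      rw [hmem] at hv ⊢
      refine ⟨bivector_mem_primitive h hA hv.1, fun w hw => ?_⟩
      have h2 := hv.2 _ (hN _ hA.transpose w hw)
      rwa [bform_bivector, Matrix.transpose_transpose] at h2
    have h2 := ((hmem _).1 h1).2 _ (setVec_highestSet_mem h hr hNK hN0 hN)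
    rw [bform_setVec, if_pos rfl] at h2
    exact one_ne_zero h2
  refine Submodule.eq_of_le_of_finrank_le hNK ?_
  let φ : primitive a c r →ₗ[ℂ] Module.Dual ℂ N :=
    N.dualRestrict ∘ₗ h.bform.flip ∘ₗ (primitive a c r).subtype
  have hφ : Function.Injective φ := by
    rw [← LinearMap.ker_eq_bot, LinearMap.ker_eq_bot']
    intro v hv
    have h1 : (v : M) ∈ N' :=
      (hmem _).2 ⟨v.2, fun w hw => LinearMap.congr_fun hv ⟨w, hw⟩⟩
    rw [hN', Submodule.mem_bot] at h1
    exact Subtype.ext h1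
  exact (LinearMap.finrank_le_finrank_of_injective hφ).trans_eq Subspace.dual_finrank_eq

/-- P^k commutes with the action, so the preimage of `N` in the primitive cell is invariant and
nonzero, hence everything. -/
lemma eq_map_lower_pow_of_invariant (h : IsFock a c Ω) {s : ℕ} (hs : s ≤ p) (k : ℕ)
    {N : Submodule ℂ M} (hNK : N ≤ (primitive a c s).map (lower a ^ k)) (hN0 : N ≠ ⊥)
    (hN : ∀ A, IsSymplecticMatrix A → ∀ v ∈ N, bivector a c A v ∈ N) :
    N = (primitive a c s).map (lower a ^ k) := by
  refine le_antisymm hNK ?_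
  have h1 : N.comap (lower a ^ k) ⊓ primitive a c s = primitive a c s := by
    refine eq_primitive_of_invariant h hs inf_le_right ?_ fun A hA v hv => ?_
    · obtain ⟨w, hw, hw0⟩ := (Submodule.ne_bot_iff N).1 hN0
      obtain ⟨v, hv, rfl⟩ := hNK hw
      exact (Submodule.ne_bot_iff _).2 ⟨v, ⟨hw, hv⟩, by rintro rfl; exact hw0 (map_zero _)⟩
    · refine ⟨?_, bivector_mem_primitive h hA hv.2⟩
      change (lower a ^ k) (bivector a c A v) ∈ N
      rw [lower_pow_bivector h hA]
      exact hN A hA _ hv.1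
  rw [Submodule.map_le_iff_le_comap]
  exact inf_eq_right.1 h1

lemma bivector_mem_map_lower_pow (h : IsFock a c Ω) {s : ℕ} (k : ℕ)
    {A : Matrix (Fin p ⊕ Fin p) (Fin p ⊕ Fin p) ℂ} (hA : IsSymplecticMatrix A) {v : M}
    (hv : v ∈ (primitive a c s).map (lower a ^ k)) :
    bivector a c A v ∈ (primitive a c s).map (lower a ^ k) := by
  obtain ⟨w, hw, rfl⟩ := hv
  exact ⟨_, bivector_mem_primitive h hA hw, lower_pow_bivector h hA k w⟩

lemma map_lower_pow_ne_bot (h : IsFock a c Ω) {s k : ℕ} (hs : s ≤ p) (hk : k ≤ p - s) :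
    (primitive a c s).map (lower a ^ k) ≠ ⊥ :=
  (Submodule.ne_bot_iff _).2 ⟨_, ⟨_, setVec_highestSet_mem_primitive h hs, rfl⟩,
    lower_pow_ne_zero h hs (setVec_highestSet_mem_primitive h hs) (h.setVec_ne_zero _) hk⟩

/-- Terms creating an odd index vanish off the diagonal, as all are occupied; triangularity and
upward closure of the even part remove the other off-diagonal terms. Diagonal entries cancel in
pairs for i ≥ r and survive for i < r, giving the weight (1_r). -/
lemma bivector_setVec_highestSet (h : IsFock a c Ω) (r : ℕ)
    {A : Matrix (Fin p ⊕ Fin p) (Fin p ⊕ Fin p) ℂ} (hA : IsSymplecticMatrix A)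
    (h1 : ∀ i j : Fin p, A (.inr i) (.inl j) = 0)
    (h2 : ∀ i j : Fin p, j < i → A (.inl i) (.inl j) = 0) :
    bivector a c A (setVec c Ω (highestSet p r)) =
      (∑ i : Fin p, (if (i : ℕ) < r then 1 else 0) * A (.inl i) (.inl i)) •
        setVec c Ω (highestSet p r) := by
  set v := setVec c Ω (highestSet p r) with hv
  have hl : ∀ i : Fin p, (.inl i : Fin p ⊕ Fin p) ∈ highestSet p r := fun i => by simp [highestSet]
  have hr : ∀ i : Fin p, (.inr i : Fin p ⊕ Fin p) ∈ highestSet p r ↔ r ≤ (i : ℕ) := fun i => by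
    simp [highestSet]
  have hll : ∀ i j : Fin p, A (.inl i) (.inl j) • c (.inl i) (a (.inl j) v) =
      if i = j then A (.inl i) (.inl i) • v else 0 := by
    intro i j
    split_ifs with hij
    · subst hij; rw [h.c_a_setVec, if_pos (hl i)]
    · rw [h.c_a_of_ne (by simpa using hij), h.c_setVec_of_mem (hl i), map_zero, neg_zero, smul_zero]
  have hlr : ∀ i j : Fin p, c (.inl i) (a (.inr j) v) = 0 := fun i j => by
    rw [h.c_a_of_ne Sum.inl_ne_inr, h.c_setVec_of_mem (hl i), map_zero, neg_zero]
  have hrr : ∀ i j : Fin p, A (.inr i) (.inr j) • c (.inr i) (a (.inr j) v) =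
      if i = j then (if r ≤ (i : ℕ) then -A (.inl i) (.inl i) else 0) • v else 0 := by
    intro i j
    rw [hA.inr_inr]
    rcases lt_trichotomy i j with hij | hij | hij
    · rw [h2 j i hij, neg_zero, zero_smul, if_neg hij.ne]
    · subst hij
      rw [h.c_a_setVec, if_pos rfl]
      simp only [hr]
      split_ifs <;> simp [hv]
    · rw [if_neg hij.ne']
      by_cases hj : r ≤ (j : ℕ)
      · have hi : r ≤ (i : ℕ) := hj.trans (Fin.le_def.1 hij.le)
        rw [h.c_a_of_ne (by simpa using hij.ne'), h.c_setVec_of_mem ((hr i).2 hi), map_zero,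
          neg_zero, smul_zero]
      · rw [h.a_setVec_of_notMem (by rwa [hr]), map_zero, smul_zero]
  rw [bivector_apply]
  simp only [Fintype.sum_sum_type, hll, hlr, hrr, h1, zero_smul, smul_zero, Finset.sum_const_zero,
    add_zero, zero_add, Finset.sum_ite_eq, Finset.mem_univ, if_true]
  rw [← Finset.sum_add_distrib, Finset.sum_smul]
  refine Finset.sum_congr rfl fun i _ => ?_
  rw [← add_smul]
  congr 1
  by_cases hi : r ≤ (i : ℕ)
  · simp [hi, hi.not_gt]
  · simp [hi, not_le.1 hi]

end IsFock
end SymplecticSpinor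

namespace SymplecticSpinor

open LieAlgebra.Symplectic IsFock

/-! ### Spinor space as a Fock space -/

/-- Left multiplication by `f_k` on spinors. -/
noncomputable def annihilate (p : ℕ) (k : WittIdx p) : Module.End ℂ (Spinor p) :=
  Algebra.lsmul ℂ ℂ (Spinor p) (f k)

/-- Left multiplication by `f_k†` on spinors. -/
noncomputable def create (p : ℕ) (k : WittIdx p) : Module.End ℂ (Spinor p) :=
  Algebra.lsmul ℂ ℂ (Spinor p) (fd k)

/-- The generators `e` are combinations of `f` and `fd`; this gives cyclicity of the vacuum in the
left ideal it generates. -/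
lemma lsmul_mem_of_stable {p : ℕ} (W : Submodule ℂ (Spinor p))
    (hf : ∀ k, ∀ v ∈ W, annihilate p k v ∈ W) (hfd : ∀ k, ∀ v ∈ W, create p k v ∈ W)
    (x : Cl p) : ∀ v ∈ W, Algebra.lsmul ℂ ℂ (Spinor p) x v ∈ W := by
  have he0 : ∀ k : WittIdx p, (e (k, 0) : Cl p) = fd k - f k := fun k => by
    rw [f_eq, fd_eq]; module
  have he1 : ∀ k : WittIdx p, (e (k, 1) : Cl p) = (-Complex.I) • (fd k + f k) := fun k => by
    rw [f_eq, fd_eq]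
    match_scalars
    · linear_combination Complex.I_mul_I
    · ring
  have he : ∀ i : EuclIdx p, ∀ v ∈ W, Algebra.lsmul ℂ ℂ (Spinor p) (e i) v ∈ W := by
    rintro ⟨k, i⟩ v hv
    fin_cases i
    · change Algebra.lsmul ℂ ℂ (Spinor p) (e (k, 0)) v ∈ W
      rw [he0, map_sub, LinearMap.sub_apply]
      exact W.sub_mem (hfd k v hv) (hf k v hv)
    · change Algebra.lsmul ℂ ℂ (Spinor p) (e (k, 1)) v ∈ W
      rw [he1, map_smul, map_add, LinearMap.smul_apply, LinearMap.add_apply]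
      exact W.smul_mem _ (W.add_mem (hfd k v hv) (hf k v hv))
  induction x using CliffordAlgebra.induction with
  | algebraMap r =>
    intro v hv
    rw [AlgHom.commutes, Module.algebraMap_end_apply]
    exact W.smul_mem r hv
  | ι x =>
    intro v hv
    have hx : CliffordAlgebra.ι (form p) x = ∑ i, x i • (e i : Cl p) := by
      conv_lhs => rw [← (Pi.basisFun ℂ (EuclIdx p)).sum_repr x]
      simp [e]
    rw [hx, map_sum, LinearMap.sum_apply]
    refine W.sum_mem fun i _ => ?_
    rw [map_smul, LinearMap.smul_apply]
    exact W.smul_mem _ (he i v hv)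
  | mul x y hx hy => intro v hv; rw [map_mul]; exact hx _ (hy v hv)
  | add x y hx hy => intro v hv; rw [map_add]; exact W.add_mem (hx v hv) (hy v hv)

lemma isFock_spinor (p : ℕ) : IsFock (annihilate p) (create p) (vac p) where
  a_a j k v := by
    rw [eq_neg_iff_add_eq_zero]
    change f j • f k • v + f k • f j • v = 0
    rw [smul_smul, smul_smul, ← add_smul, f_mul_f, zero_smul]
  c_c j k v := by
    rw [eq_neg_iff_add_eq_zero]
    change fd j • fd k • v + fd k • fd j • v = 0
    rw [smul_smul, smul_smul, ← add_smul, fd_mul_fd, zero_smul]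
  a_c j k v := by
    rw [eq_sub_iff_add_eq]
    change f j • fd k • v + fd k • f j • v = _
    rw [smul_smul, smul_smul, ← add_smul, f_mul_fd]
    split_ifs <;> simp
  a_vac := f_smul_vac
  vac_ne_zero := vac_ne_zero p
  cyclic W hvac hf hfd := by
    rintro ⟨s, hs⟩ -
    obtain ⟨x, rfl⟩ := Ideal.mem_span_singleton'.1 hs
    exact lsmul_mem_of_stable W hf hfd x _ hvac

/-! ### Translation of the cells and of the Lie action -/

lemma P_eq_lower (p : ℕ) : P p = lower (annihilate p) := by
  rw [P, lower, map_sum]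
  exact Finset.sum_congr rfl fun j _ => map_mul _ _ _

lemma Q_eq_raise (p : ℕ) : Q p = raise (create p) := by
  rw [Q, raise, map_sum]
  exact Finset.sum_congr rfl fun j _ => map_mul _ _ _

lemma list_prod_smul_vac {p : ℕ} (L : List (WittIdx p)) :
    (L.map fun k => (fd k : Cl p)).prod • vac p = listVec (create p) (vac p) L := by
  induction L with
  | nil => simp [listVec]
  | cons k L ih =>
    rw [List.map_cons, List.prod_cons, mul_smul, ih]
    rfl

lemma homSpinor_eq (p t : ℕ) : homSpinor p t =
    Module.End.eigenspace (number (annihilate p) (create p)) (t : ℂ) := by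
  rw [← (isFock_spinor p).span_listVec, homSpinor]
  congr 2
  ext1 k
  rw [← list_prod_smul_vac, List.map_ofFn]
  rfl

lemma kerCell_eq (p s : ℕ) : kerCell p s = primitive (annihilate p) (create p) s := by
  rw [kerCell, primitive, Q_eq_raise, homSpinor_eq]

lemma cell_eq (p s k : ℕ) : cell p s k =
    (primitive (annihilate p) (create p) s).map (lower (annihilate p) ^ k) := by
  rw [cell, kerCell_eq, P_eq_lower]

lemma lie_eq_bivector {p : ℕ} (A : Sp p) (v : Spinor p) :
    ⁅A, v⁆ = bivector (annihilate p) (create p) A.1 v := by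
  have h : bivector (annihilate p) (create p) A.1 =
      Algebra.lsmul ℂ ℂ (Spinor p) (∑ j, ∑ k, A.1 j k • (fd j * f k)) := by
    simp only [bivector, map_sum, map_smul, map_mul]
    rfl
  rw [h]
  rfl

/-- The condition AᵀJ = -JA, read block by block. -/
lemma mem_sp_iff {p : ℕ} {A : Matrix (WittIdx p) (WittIdx p) ℂ} :
    A ∈ sp (Fin p) ℂ ↔ IsSymplecticMatrix A := by
  have hA : A ∈ sp (Fin p) ℂ ↔ A.transpose * Matrix.J (Fin p) ℂ = Matrix.J (Fin p) ℂ * -A := by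
    rw [sp, mem_skewAdjointMatricesLieSubalgebra, mem_skewAdjointMatricesSubmodule]
    rfl
  rw [hA]
  conv_lhs => rw [← Matrix.fromBlocks_toBlocks A]
  rw [Matrix.J, Matrix.fromBlocks_transpose, Matrix.fromBlocks_neg, Matrix.fromBlocks_multiply,
    Matrix.fromBlocks_multiply, Matrix.fromBlocks_inj]
  simp only [← Matrix.ext_iff, Matrix.mul_zero, Matrix.zero_mul, Matrix.mul_one, Matrix.one_mul,
    Matrix.mul_neg, Matrix.neg_mul, zero_add, add_zero, neg_neg, neg_zero, Matrix.neg_apply,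
    Matrix.transpose_apply, Matrix.toBlocks₁₁, Matrix.toBlocks₁₂, Matrix.toBlocks₂₁,
    Matrix.toBlocks₂₂, Matrix.of_apply, neg_inj]
  constructor
  · rintro ⟨h1, h2, h3, h4⟩
    exact ⟨fun i j => (h2 i j).symm, fun i j => (h4 i j).symm, fun i j => (h1 i j).symm⟩
  · rintro ⟨h1, h2, h3⟩
    exact ⟨fun i j => h3 j i, fun i j => (h1 i j).symm, fun i j => by rw [h1],
      fun i j => h2 j i⟩

lemma isIrreducible_of_forall_le {R L M : Type*} [CommRing R] [LieRing L] [AddCommGroup M]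
    [Module R M] [LieRingModule L M] (N : LieSubmodule R L M) (hN0 : N ≠ ⊥)
    (hN : ∀ N' : LieSubmodule R L M, N' ≤ N → N' ≠ ⊥ → N' = N) :
    LieModule.IsIrreducible R L N := by
  have : Nontrivial N := (LieSubmodule.nontrivial_iff_ne_bot R L M).2 hN0
  refine LieModule.IsIrreducible.mk fun N' hN' => ?_
  have h1 := hN (N'.map N.incl) ?_ ?_
  · rw [eq_top_iff]
    rintro ⟨x, hx⟩ -
    have hx2 := hx
    rw [← h1] at hx2
    obtain ⟨y, hy, hyx⟩ := (LieSubmodule.mem_map x).1 hx2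
    obtain rfl : y = ⟨x, hx⟩ := Subtype.ext hyx
    exact hy
  · intro x hx
    obtain ⟨y, -, rfl⟩ := (LieSubmodule.mem_map x).1 hx
    exact y.2
  · contrapose! hN'
    rw [LieSubmodule.eq_bot_iff] at hN' ⊢
    exact fun y hy => Subtype.ext (hN' y ((LieSubmodule.mem_map _).2 ⟨y, hy, rfl⟩))

/-- The cell `𝕊_s^{2p-s-2k}` as a Lie submodule of spinor space. -/
noncomputable def lieCell (p s k : ℕ) : LieSubmodule ℂ (Sp p) (Spinor p) where
  toSubmodule := cell p s k
  lie_mem {A v} hv := by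
    change ⁅A, v⁆ ∈ cell p s k
    change v ∈ cell p s k at hv
    rw [cell_eq] at hv ⊢
    rw [lie_eq_bivector]
    exact bivector_mem_map_lower_pow (isFock_spinor p) k (mem_sp_iff.1 A.2) hv

lemma isIrreducible_lieCell {p s k : ℕ} (hs : s ≤ p) (hk : k ≤ p - s) :
    LieModule.IsIrreducible ℂ (Sp p) (lieCell p s k) := by
  refine isIrreducible_of_forall_le _ ?_ fun N hNK hN0 => ?_
  · rw [Ne, ← LieSubmodule.toSubmodule_eq_bot]
    change cell p s k ≠ ⊥
    rw [cell_eq]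
    exact map_lower_pow_ne_bot (isFock_spinor p) hs hk
  · have hNK' : N.toSubmodule ≤ cell p s k := hNK
    refine LieSubmodule.toSubmodule_injective ?_
    change N.toSubmodule = cell p s k
    rw [cell_eq] at hNK' ⊢
    refine eq_map_lower_pow_of_invariant (isFock_spinor p) hs k hNK'
      (by rwa [Ne, LieSubmodule.toSubmodule_eq_bot]) fun A hA v hv => ?_
    have h1 := N.lie_mem (x := (⟨A, mem_sp_iff.2 hA⟩ : Sp p)) hv
    rwa [lie_eq_bivector] at h1

end SymplecticSpinor

theorem mainTheorem2 (p r : ℕ) (hr : r ≤ p) :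
    (∃ N : LieSubmodule ℂ (SymplecticSpinor.Sp p) (SymplecticSpinor.Spinor p),
      N.toSubmodule = SymplecticSpinor.kerCell p r ∧
      SymplecticSpinor.IsIrreducibleOfHighestWeight N (SymplecticSpinor.oneWeight p r)) ∧
    (∀ j ≤ r / 2, ∃ N : LieSubmodule ℂ (SymplecticSpinor.Sp p) (SymplecticSpinor.Spinor p),
      N.toSubmodule = SymplecticSpinor.cell p (r - 2 * j) j ∧
      LieModule.IsIrreducible ℂ (SymplecticSpinor.Sp p) N) ∧
    iSupIndep (fun j : Fin (r / 2 + 1) => SymplecticSpinor.cell p (r - 2 * (j : ℕ)) j) ∧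
    ⨆ j : Fin (r / 2 + 1), SymplecticSpinor.cell p (r - 2 * (j : ℕ)) j =
      SymplecticSpinor.homSpinor p (2 * p - r) := by
  open SymplecticSpinor SymplecticSpinor.IsFock in
  have h := isFock_spinor p
  refine ⟨⟨lieCell p r 0, ?_, isIrreducible_lieCell hr (Nat.zero_le _), ?_⟩, fun j hj =>
    ⟨lieCell p (r - 2 * j) j, rfl, isIrreducible_lieCell (by omega) (by omega)⟩, ?_, ?_⟩
  · change cell p r 0 = kerCell p r
    rw [cell, pow_zero, Module.End.one_eq_id, Submodule.map_id]
  · have hmem : setVec (create p) (vac p) (highestSet p r) ∈ lieCell p r 0 := by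
      change _ ∈ cell p r 0
      rw [cell_eq]
      exact ⟨_, setVec_highestSet_mem_primitive h hr, rfl⟩
    refine ⟨⟨_, hmem⟩, fun h0 => h.setVec_ne_zero _ (congrArg Subtype.val h0), ?_⟩
    intro A h1 h2
    refine Subtype.ext ?_
    change ⁅A, setVec (create p) (vac p) (highestSet p r)⁆ = _
    rw [lie_eq_bivector, bivector_setVec_highestSet h r (mem_sp_iff.1 A.2) h1 h2]
    rfl
  · simp only [cell_eq]
    exact iSupIndep_map_lower_pow h hr
  · simp only [cell_eq, homSpinor_eq]
    exact iSup_map_lower_pow h hr
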